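/- Work on $\mathbb R^{2n}$ with coordinates $(q_1,\dots,q_n,p_1,\dots,p_n)$; all objects are smooth. **Definitions.** For a bivector $\pi$ let $\langle\beta,\pi^\sharp\alpha\rangle=\pi(\alpha,\beta)$; for a 2-form $\Omega$ let $\Omega^\flat(X)=i_X\Omega$. For a $(1,1)$ tensor field $N$ let $N^*$ be its transpose, $T_N(X,Y)=[NX,NY]-N([NX,Y]+[X,NY]-N[X,Y])$ its torsion, $(i_N\alpha)(X_1,\dots,X_k)=\sum_i\alpha(X_1,\dots,NX_i,\dots,X_k)$ and $d_N=i_N\circ d-d\circ i_N$ on forms. A Poisson bivector $\pi$ and $N$ are compatible if $N\pi^\sharp=\pi^\sharp N^*$ and $L_{\pi^\sharp\alpha}(N)X-\pi^\sharp L_X(N^*\alpha)+\pi^\sharp L_{NX}\alpha=0$ for all 1-forms $\alpha$ and vector fields $X$. $(\pi,N)$ is a Poisson–Nijenhuis (PN) structure if $\pi$ is Poisson, $\pi$ and $N$ are compatible and $T_N=0$; $(\pi,N,\phi)$, with $\phi$ a 3-form, is a Poisson quasi-Nijenhuis (PqN) structure if $\pi$ is Poisson, $\pi$ and $N$ are compatible,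 $d\phi=0$, $d(i_N\phi)=0$ and $T_N(X,Y)=\pi^\sharp(\phi(X,Y,\cdot))$ for all vector fields $X,Y$. $[\cdot,\cdot]_\pi$ is the Koszul bracket of forms, with the sign convention $[\alpha,f]_\pi=\langle df,\pi^\sharp\alpha\rangle$ for a 1-form $\alpha$ and a function $f$; on 2-forms $[\eta,\eta']_\pi=\Delta(\eta\wedge\eta')-\Delta\eta\wedge\eta'-\eta\wedge\Delta\eta'$ with $\Delta=i_\pi d-d\,i_\pi$ and $i_\pi(\alpha\wedge\beta)=\pi(\alpha,\beta)$. **Statement.** Let $\pi=\sum_i\partial_{p_i}\wedge\partial_{q_i}$ and $N=\sum_i p_i(\partial_{q_i}\otimes dq_i+\partial_{p_i}\otimes dp_i)$. Then $(\pi,N)$ is a PN structure. *(1) General potentials.* Let $V_{ij}$ ($1\le i<j\le n$) be $C^\infty$ functions of one variable, write $V_{ij}$, $V_{ij}'$ for $V_{ij}(q_i-q_j)$, $V'_{ij}(q_i-q_j)$, and put $$\Omega=\sum_{i<j}\bigl(V_{ij}\,dq_j\wedge dq_i+dp_j\wedge dp_i\bigr),\qquad \widehat N=N+\pi^\sharp\Omega^\flat,\qquad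 \phi=d_N\Omega+\tfrac12[\Omega,\Omega]_\pi .$$ Then $d\Omega=0$; more precisely $\Omega=d\theta$ with $\theta=\sum_{i<j}(-\widetilde V_{ij}(q_i-q_j)\,dq_i+p_j\,dp_i)$ for any primitives $\widetilde V_{ij}$ of $V_{ij}$. Moreover $$\widehat N=N+\sum_{i<j}(\partial_{q_i}\otimes dp_j-\partial_{q_j}\otimes dp_i)+\sum_{i<j}V_{ij}(\partial_{p_j}\otimes dq_i-\partial_{p_i}\otimes dq_j),$$ $$d_N\Omega=\sum_{i<j}V_{ij}\,dq_i\wedge dq_j\wedge(dp_i+dp_j),$$ $$[\Omega,\Omega]_\pi=2\sum_{i<j}V'_{ij}\,dq_i\wedge dq_j\wedge\sum_{k<l}\bigl((\delta_{il}-\delta_{jl})dp_k+(\delta_{jk}-\delta_{ik})dp_l\bigr),$$ and $(\pi,\widehat N,\phi)$ is a PqN structure. *(2) Toda potentials.* Let $n\ge2$, let $f_1,\dots,f_n\in\mathbb R$, and take $V_{i,i+1}(t)=f_ie^{t}$ for $1\le i\le n-1$, $V_{1n}(t)=f_ne^{-t}$ and $V_{ij}=0$ otherwise (for $n=2$: $V_{12}(t)=f_1e^t+f_2e^{-t}$).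 Then $$\widehat N=N+\sum_{i<j}(\partial_{q_i}\otimes dp_j-\partial_{q_j}\otimes dp_i)+\sum_{i=1}^{n-1}f_ie^{q_i-q_{i+1}}(\partial_{p_{i+1}}\otimes dq_i-\partial_{p_i}\otimes dq_{i+1})-f_ne^{q_n-q_1}(\partial_{p_1}\otimes dq_n-\partial_{p_n}\otimes dq_1),$$ $$\phi=2f_n\,e^{q_n-q_1}\,dq_1\wedge dq_n\wedge\sum_{i=1}^n dp_i,$$ and $(\pi,\widehat N,\phi)$ is a PqN structure. (a) If $f_i=1$ for all $i$, then $\widehat N$ and $\phi$ are the tensor field and the 3-form of the PqN structure of the closed Toda lattice, that is, those displayed above with $f_1=\dots=f_n=1$; moreover $\tfrac12\operatorname{Tr}\widehat N=\sum_i p_i$ and $\tfrac14\operatorname{Tr}\widehat N^2=\tfrac12\sum_i p_i^2+\sum_{i=1}^{n-1}e^{q_i-q_{i+1}}+e^{q_n-q_1}$. (b) If $f_n=0$, then $\phi=d_N\Omega+\tfrac12[\Omega,\Omega]_\pi=0$, $\widehat N$ is the Das–Okubo tensor field of the open Toda lattice (with constants $f_1,\dots,f_{n-1}$), that is, the tensor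 field displayed above without its last term, and $(\pi,\widehat N)$ is a PN structure. -/

import Mathlib

open scoped ContDiff

namespace PqN

noncomputable section

/-! ### Exterior algebra over a real normed space -/

/-- The product `v ↦ α (v₀, …, v_{k-1}) * β (v_k, …, v_{k+l-1})`, before antisymmetrisation. -/
def mulMultilinear {V : Type*} [NormedAddCommGroup V] [NormedSpace ℝ V] {k l : ℕ}
    (α : V [⋀^Fin k]→L[ℝ] ℝ) (β : V [⋀^Fin l]→L[ℝ] ℝ) :
    ContinuousMultilinearMap ℝ (fun _ : Fin (k + l) => V) ℝ where
  toMultilinearMap :=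
    (LinearMap.mul' ℝ ℝ).compMultilinearMap
      ((α.toAlternatingMap.toMultilinearMap.domCoprod
        β.toAlternatingMap.toMultilinearMap).domDomCongr finSumFinEquiv)
  cont := by
    change Continuous fun v : Fin (k + l) → V =>
      α (fun i => v (finSumFinEquiv (Sum.inl i))) * β (fun i => v (finSumFinEquiv (Sum.inr i)))
    exact (α.cont.comp (by fun_prop)).mul (β.cont.comp (by fun_prop))

/-- The wedge product, normalised so that `(α ∧ β) (u, v) = α u * β v - α v * β u` for covectors. -/
def wedge {V : Type*} [NormedAddCommGroup V] [NormedSpace ℝ V] {k l : ℕ}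
    (α : V [⋀^Fin k]→L[ℝ] ℝ) (β : V [⋀^Fin l]→L[ℝ] ℝ) : V [⋀^Fin (k + l)]→L[ℝ] ℝ :=
  ((k.factorial : ℝ) * (l.factorial : ℝ))⁻¹ •
    ContinuousMultilinearMap.alternatization (mulMultilinear α β)

theorem wedge_apply {V : Type*} [NormedAddCommGroup V] [NormedSpace ℝ V] {k l : ℕ}
    (α : V [⋀^Fin k]→L[ℝ] ℝ) (β : V [⋀^Fin l]→L[ℝ] ℝ) (v : Fin (k + l) → V) :
    wedge α β v = ((k.factorial : ℝ) * (l.factorial : ℝ))⁻¹ *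
      ∑ σ : Equiv.Perm (Fin (k + l)), Equiv.Perm.sign σ •
        (α (fun i => v (σ (Fin.castAdd l i))) * β (fun i => v (σ (Fin.natAdd k i)))) := by
  simp only [wedge, ContinuousAlternatingMap.smul_apply,
    ContinuousMultilinearMap.alternatization_apply_apply, smul_eq_mul]
  rfl

/-- A covector, seen as an alternating form of degree one. -/
def covec {V : Type*} [NormedAddCommGroup V] [NormedSpace ℝ V] (α : V →L[ℝ] ℝ) :
    V [⋀^Fin 1]→L[ℝ] ℝ :=
  ContinuousAlternatingMap.ofSubsingleton ℝ V ℝ (0 : Fin 1) α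

/-- `(i_A α) (v₁, …, v_k) = ∑ i, α (v₁, …, A vᵢ, …, v_k)`, see `insertEndo_apply`. -/
def insertEndo {V : Type*} [NormedAddCommGroup V] [NormedSpace ℝ V] {k : ℕ}
    (A : V →L[ℝ] V) (α : V [⋀^Fin k]→L[ℝ] ℝ) : V [⋀^Fin k]→L[ℝ] ℝ where
  toContinuousMultilinearMap :=
    ∑ i, α.toContinuousMultilinearMap.compContinuousLinearMap
      (fun j => if j = i then A else ContinuousLinearMap.id ℝ V)
  map_eq_zero_of_eq' := by
    intro v i j hv hij
    have key : ∀ r : Fin k, (α.toContinuousMultilinearMap.compContinuousLinearMap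
        (fun j => if j = r then A else ContinuousLinearMap.id ℝ V)) v
        = α (Function.update v r (A (v r))) := by
      intro r
      change α (fun s => (if s = r then A else ContinuousLinearMap.id ℝ V) (v s)) = _
      congr 1
      funext s
      by_cases h : s = r
      · subst h; simp
      · simp [h]
    change (∑ r, α.toContinuousMultilinearMap.compContinuousLinearMap
        (fun j => if j = r then A else ContinuousLinearMap.id ℝ V)) v = 0
    rw [_root_.sum_apply]
    simp only [key]
    rw [Finset.sum_eq_add i j hij]
    · have hsw : Function.update v j (A (v j))
          = Function.update v i (A (v i)) ∘ Equiv.swap i j := by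
        funext s
        by_cases h1 : s = i
        · subst h1; simp [hij, hij.symm, hv]
        · by_cases h2 : s = j
          · subst h2; simp [hv]
          · simp [h1, h2, Equiv.swap_apply_of_ne_of_ne h1 h2]
      have hs := α.toAlternatingMap.map_swap (Function.update v i (A (v i))) hij
      change α (Function.update v i (A (v i)) ∘ Equiv.swap i j)
        = -α (Function.update v i (A (v i))) at hs
      rw [hsw, hs, add_neg_cancel]
    · intro r _ hr
      exact α.map_eq_zero_of_eq _ (by simp [hr.1.symm, hr.2.symm, hv]) hij
    · intro h; exact absurd (Finset.mem_univ _) h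
    · intro h; exact absurd (Finset.mem_univ _) h

theorem insertEndo_apply {V : Type*} [NormedAddCommGroup V] [NormedSpace ℝ V] {k : ℕ}
    (A : V →L[ℝ] V) (α : V [⋀^Fin k]→L[ℝ] ℝ) (v : Fin k → V) :
    insertEndo A α v = ∑ i, α (Function.update v i (A (v i))) := by
  change (∑ r, α.toContinuousMultilinearMap.compContinuousLinearMap
        (fun j => if j = r then A else ContinuousLinearMap.id ℝ V)) v = _
  rw [_root_.sum_apply]
  refine Finset.sum_congr rfl fun r _ => ?_
  change α (fun s => (if s = r then A else ContinuousLinearMap.id ℝ V) (v s)) = _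
  congr 1
  funext s
  by_cases h : s = r
  · subst h; simp
  · simp [h]

/-! ### Tensor calculus on `ℝ^ι` -/

/-- Differential forms of degree `k` on `ℝ^ι`. -/
abbrev Form (ι : Type) [Fintype ι] (k : ℕ) : Type := (ι → ℝ) → (ι → ℝ) [⋀^Fin k]→L[ℝ] ℝ

/-- Differential 1-forms on `ℝ^ι`, as fields of covectors. -/
abbrev CovectorField (ι : Type) [Fintype ι] : Type := (ι → ℝ) → ((ι → ℝ) →L[ℝ] ℝ)

/-- Vector fields on `ℝ^ι`. -/
abbrev VField (ι : Type) : Type := (ι → ℝ) → (ι → ℝ)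

/-- Tensor fields of type `(1,1)` on `ℝ^ι`, i.e. fields of endomorphisms. -/
abbrev EndoField (ι : Type) [Fintype ι] : Type := (ι → ℝ) → ((ι → ℝ) →L[ℝ] (ι → ℝ))

/-- Bivector fields on `ℝ^ι`, i.e. fields of alternating bilinear forms on covectors. -/
abbrev Bivector (ι : Type) [Fintype ι] : Type :=
  (ι → ℝ) → ((ι → ℝ) →L[ℝ] ℝ) [⋀^Fin 2]→L[ℝ] ℝ

section Calculus

variable {ι : Type} [Fintype ι]

/-- The coordinate covector `dx_a`. -/
def dx (a : ι) : (ι → ℝ) →L[ℝ] ℝ := ContinuousLinearMap.proj a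

/-- The coordinate vector `∂_a`. -/
def basisVec {ι : Type} [DecidableEq ι] (a : ι) : ι → ℝ := Pi.single a 1

/-- `π♯`, determined by `⟨β, π♯ α⟩ = π (α, β)`. -/
def sharp (P : Bivector ι) (x : ι → ℝ) : ((ι → ℝ) →L[ℝ] ℝ) →L[ℝ] (ι → ℝ) :=
  ContinuousLinearMap.pi fun a => (P x).toContinuousLinearMap ![0, dx a] 0

theorem sharp_apply (P : Bivector ι) (x : ι → ℝ) (α : (ι → ℝ) →L[ℝ] ℝ) (a : ι) :
    sharp P x α a = P x ![α, dx a] := by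
  change P x (Function.update ![0, dx a] 0 α) = _
  congr 1
  funext i
  fin_cases i <;> rfl

/-- `Ω♭ v = i_v Ω = Ω (v, ·)`. -/
def flat (Ω : Form ι 2) (x : ι → ℝ) : (ι → ℝ) →L[ℝ] ((ι → ℝ) →L[ℝ] ℝ) :=
  LinearMap.toContinuousLinearMap
    { toFun := fun v =>
        (ContinuousAlternatingMap.ofSubsingleton ℝ (ι → ℝ) ℝ (0 : Fin 1)).symm
          ((Ω x).curryLeft v)
      map_add' := by
        intro u v
        ext w
        simp [map_add]
      map_smul' := by
        intro c v
        ext w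
        simp [map_smul] }

theorem flat_apply (Ω : Form ι 2) (x v w : ι → ℝ) : flat Ω x v w = Ω x ![v, w] := by
  change Ω x (Matrix.vecCons v fun _ => w) = _
  congr 1
  funext i
  fin_cases i <;> rfl

/-- The 1-form `i_{X ∧ Y} φ = φ (X, Y, ·)`. -/
def contract₂ (φ : Form ι 3) (X Y : VField ι) : CovectorField ι := fun x =>
  (φ x).toContinuousLinearMap ![X x, Y x, 0] 2

theorem contract₂_apply (φ : Form ι 3) (X Y : VField ι) (x v : ι → ℝ) :
    contract₂ φ X Y x v = φ x ![X x, Y x, v] := by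
  change φ x (Function.update ![X x, Y x, 0] 2 v) = _
  congr 1
  funext i
  fin_cases i <;> rfl

/-- The Lie bracket of vector fields. -/
def bracket (X Y : VField ι) : VField ι := VectorField.lieBracket ℝ X Y

/-- The Lie derivative of a 1-form: `(L_X α) (v) = (D_X α) (v) + α (D_v X)` for constant `v`,
equivalently `(L_X α) (Y) = X (α (Y)) - α ([X, Y])`. -/
def lieCovector (X : VField ι) (α : CovectorField ι) : CovectorField ι := fun x =>
  fderiv ℝ α x (X x) + (α x).comp (fderiv ℝ X x)

/-- `N X`. -/
def endoApply (N : EndoField ι) (X : VField ι) : VField ι := fun x => N x (X x)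

/-- `N* α`, with `N*` the transpose of `N`. -/
def transposeApply (N : EndoField ι) (α : CovectorField ι) : CovectorField ι := fun x =>
  (α x).comp (N x)

/-- `π♯ α`, for a 1-form `α`. -/
def sharpField (P : Bivector ι) (α : CovectorField ι) : VField ι := fun x => sharp P x (α x)

/-- The Lie derivative of a `(1,1)` tensor field applied to a vector field:
`(L_Y N) X = [Y, N X] - N [Y, X]`. -/
def lieEndo (Y : VField ι) (N : EndoField ι) (X : VField ι) : VField ι := fun x =>
  bracket Y (endoApply N X) x - N x (bracket Y X x)

/-- The Nijenhuis torsion `T_N (X, Y) = [NX, NY] - N ([NX, Y] + [X, NY] - N [X, Y])`. -/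
def torsion (N : EndoField ι) (X Y : VField ι) : VField ι := fun x =>
  bracket (endoApply N X) (endoApply N Y) x
    - N x (bracket (endoApply N X) Y x + bracket X (endoApply N Y) x - N x (bracket X Y x))

/-- `i_N α`, for a form `α`. -/
def insertN (N : EndoField ι) {k : ℕ} (α : Form ι k) : Form ι k := fun x => insertEndo (N x) (α x)

/-- The differential `d_N = i_N ∘ d - d ∘ i_N` attached to a `(1,1)` tensor field. -/
def dN (N : EndoField ι) {k : ℕ} (α : Form ι k) : Form ι (k + 1) := fun x =>
  insertN N (extDeriv α) x - extDeriv (insertN N α) x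

/-- Contraction with a bivector, `i_π η = ∑_{a < b} π(dx_a, dx_b) η (∂_a, ∂_b, …)`, so that
`i_π (α ∧ β) = π (α, β)`. The sum below runs over all `(a, b)`, whence the factor `1 / 2`. -/
def contractBivector [DecidableEq ι] (P : Bivector ι) {k : ℕ} (η : Form ι (k + 2)) : Form ι k := fun x =>
  (1 / 2 : ℝ) • ∑ a, ∑ b,
    P x ![dx a, dx b] • ((η x).curryLeft (basisVec a)).curryLeft (basisVec b)

/-- The Koszul–Brylinski operator `Δ = i_π ∘ d - d ∘ i_π` on forms of degree at least two. -/
def brylinski [DecidableEq ι] (P : Bivector ι) {k : ℕ} (η : Form ι (k + 2)) : Form ι (k + 1) := fun x =>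
  contractBivector P (extDeriv η) x - extDeriv (contractBivector P η) x

/-- The Koszul bracket `[η, η']_π` of two 2-forms. The Koszul bracket of forms of degrees `q, q'`
is generated by `Δ`,
`[η, η']_π = (-1)^q (Δ (η ∧ η') - Δ η ∧ η' - (-1)^q η ∧ Δ η')`.
With the sign of `Δ` used here, `[α, f]_π = π (α, df)` and `[df, dg]_π = d (π (df, dg))`. -/
def koszul [DecidableEq ι] (P : Bivector ι) (η η' : Form ι 2) : Form ι 3 := fun x =>
  brylinski P (k := 2) (fun y => wedge (η y) (η' y)) x
    - wedge (k := 1) (l := 2) (brylinski P (k := 0) η x) (η' x)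
    - wedge (k := 2) (l := 1) (η x) (brylinski P (k := 0) η' x)

/-- The bracket of functions `{f, g} = π (df, dg)`. -/
def poissonBracket (P : Bivector ι) (f g : (ι → ℝ) → ℝ) : (ι → ℝ) → ℝ := fun x =>
  P x ![fderiv ℝ f x, fderiv ℝ g x]

/-- `π` is a (smooth) Poisson bivector: its bracket of functions satisfies the Jacobi identity. -/
structure IsPoisson (P : Bivector ι) : Prop where
  smooth : ContDiff ℝ ∞ P
  jacobi : ∀ f g h : (ι → ℝ) → ℝ, ContDiff ℝ ∞ f → ContDiff ℝ ∞ g → ContDiff ℝ ∞ h → ∀ x,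
    poissonBracket P f (poissonBracket P g h) x + poissonBracket P g (poissonBracket P h f) x
      + poissonBracket P h (poissonBracket P f g) x = 0

/-- Compatibility of a bivector and a `(1,1)` tensor field. -/
structure Compatible (P : Bivector ι) (N : EndoField ι) : Prop where
  sharp_comm : ∀ (x : ι → ℝ) (α : (ι → ℝ) →L[ℝ] ℝ),
    N x (sharp P x α) = sharp P x (α.comp (N x))
  concomitant : ∀ (α : CovectorField ι) (X : VField ι), ContDiff ℝ ∞ α → ContDiff ℝ ∞ X → ∀ x,
    lieEndo (sharpField P α) N X x - sharp P x (lieCovector X (transposeApply N α) x)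
      + sharp P x (lieCovector (endoApply N X) α x) = 0

/-- `(ℝ^ι, π, N)` is a Poisson–Nijenhuis manifold. -/
structure IsPN (P : Bivector ι) (N : EndoField ι) : Prop where
  poisson : IsPoisson P
  smooth : ContDiff ℝ ∞ N
  compatible : Compatible P N
  torsion_eq : ∀ X Y : VField ι, ContDiff ℝ ∞ X → ContDiff ℝ ∞ Y → ∀ x, torsion N X Y x = 0

/-- `(ℝ^ι, π, N, φ)` is a Poisson quasi-Nijenhuis manifold. -/
structure IsPqN (P : Bivector ι) (N : EndoField ι) (φ : Form ι 3) : Prop where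
  poisson : IsPoisson P
  smooth : ContDiff ℝ ∞ N
  smooth_form : ContDiff ℝ ∞ φ
  compatible : Compatible P N
  closed : ∀ x, extDeriv φ x = 0
  closed_insert : ∀ x, extDeriv (insertN N φ) x = 0
  torsion_eq : ∀ X Y : VField ι, ContDiff ℝ ∞ X → ContDiff ℝ ∞ Y → ∀ x,
    torsion N X Y x = sharp P x (contract₂ φ X Y x)

/-- The deformed tensor field `N + π♯ Ω♭`. -/
def deform (P : Bivector ι) (N : EndoField ι) (Ω : Form ι 2) : EndoField ι := fun x =>
  N x + (sharp P x).comp (flat Ω x)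

/-- The 3-form `d_N Ω + ½ [Ω, Ω]_π`. -/
def deformForm [DecidableEq ι] (P : Bivector ι) (N : EndoField ι) (Ω : Form ι 2) : Form ι 3 := fun x =>
  dN N Ω x + (1 / 2 : ℝ) • koszul P Ω Ω x

/-- The functions `H_k = Tr (N^k) / (2k)`. -/
def traceH (N : EndoField ι) (k : ℕ) : (ι → ℝ) → ℝ := fun x =>
  1 / (2 * (k : ℝ)) * LinearMap.trace ℝ (ι → ℝ) ((N x : (ι → ℝ) →ₗ[ℝ] (ι → ℝ)) ^ k)

/-- The endomorphism `∂_a ⊗ dx_b`. -/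
def tens [DecidableEq ι] (a b : ι) : (ι → ℝ) →L[ℝ] (ι → ℝ) := (dx b).smulRight (basisVec a)

/-- `dx_a ∧ dx_b`. -/
def wedge₂ (a b : ι) : (ι → ℝ) [⋀^Fin 2]→L[ℝ] ℝ :=
  wedge (k := 1) (l := 1) (covec (dx a)) (covec (dx b))

/-- `dx_a ∧ dx_b ∧ dx_c`. -/
def wedge₃ (a b c : ι) : (ι → ℝ) [⋀^Fin 3]→L[ℝ] ℝ :=
  wedge (k := 2) (l := 1) (wedge₂ a b) (covec (dx c))

/-- `∂_a ∧ ∂_b`, vectors being viewed as linear forms on covectors. -/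
def biwedge [DecidableEq ι] (a b : ι) : ((ι → ℝ) →L[ℝ] ℝ) [⋀^Fin 2]→L[ℝ] ℝ :=
  wedge (k := 1) (l := 1) (covec (ContinuousLinearMap.apply ℝ ℝ (basisVec a)))
    (covec (ContinuousLinearMap.apply ℝ ℝ (basisVec b)))

end Calculus

/-! ### The phase space `ℝ^{2n}` with coordinates `(q, p)` -/

/-- Index set of the coordinates of `ℝ^{2n}`: `qIdx i` labels `q_i`, and `pIdx i` labels `p_i`. -/
abbrev Idx (n : ℕ) : Type := Fin n ⊕ Fin n

abbrev qIdx {n : ℕ} (i : Fin n) : Idx n := Sum.inl i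

abbrev pIdx {n : ℕ} (i : Fin n) : Idx n := Sum.inr i

/-- `ℝ^{2n}`. -/
abbrev Phase (n : ℕ) : Type := Idx n → ℝ

/-- The canonical Poisson tensor `∑ ∂_{p_i} ∧ ∂_{q_i}`. -/
def canonicalP (n : ℕ) : Bivector (Idx n) := fun _ => ∑ i : Fin n, biwedge (pIdx i) (qIdx i)

/-- `∑ p_i (∂_{q_i} ⊗ dq_i + ∂_{p_i} ⊗ dp_i)`. -/
def canonicalN (n : ℕ) : EndoField (Idx n) := fun x =>
  ∑ i : Fin n, x (pIdx i) • (tens (qIdx i) (qIdx i) + tens (pIdx i) (pIdx i))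

/-- `Ω = ∑_{i<j} (V_ij(q_i - q_j) dq_j ∧ dq_i + dp_j ∧ dp_i)`. -/
def potOmega {n : ℕ} (V : Fin n → Fin n → ℝ → ℝ) : Form (Idx n) 2 := fun x =>
  ∑ i, ∑ j ∈ Finset.Ioi i,
    (V i j (x (qIdx i) - x (qIdx j)) • wedge₂ (qIdx j) (qIdx i) + wedge₂ (pIdx j) (pIdx i))

/-- `θ = ∑_{i<j} (-W_ij(q_i - q_j) dq_i + p_j dp_i)`. -/
def potTheta {n : ℕ} (W : Fin n → Fin n → ℝ → ℝ) : Form (Idx n) 1 := fun x =>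
  ∑ i, ∑ j ∈ Finset.Ioi i,
    (-(W i j (x (qIdx i) - x (qIdx j))) • covec (dx (qIdx i)) + x (pIdx j) • covec (dx (pIdx i)))

/-- `∑ p_i (∂_{q_i} ⊗ dq_i + ∂_{p_i} ⊗ dp_i) + ∑_{i<j} (∂_{q_i} ⊗ dp_j - ∂_{q_j} ⊗ dp_i)
+ ∑_{i<j} V_ij(q_i - q_j) (∂_{p_j} ⊗ dq_i - ∂_{p_i} ⊗ dq_j)`. -/
def potN {n : ℕ} (V : Fin n → Fin n → ℝ → ℝ) : EndoField (Idx n) := fun x =>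
  ∑ i : Fin n, x (pIdx i) • (tens (qIdx i) (qIdx i) + tens (pIdx i) (pIdx i))
    + ∑ i : Fin n, ∑ j ∈ Finset.Ioi i, (tens (qIdx i) (pIdx j) - tens (qIdx j) (pIdx i))
    + ∑ i : Fin n, ∑ j ∈ Finset.Ioi i,
        V i j (x (qIdx i) - x (qIdx j)) • (tens (pIdx j) (qIdx i) - tens (pIdx i) (qIdx j))

/-- Kronecker's delta. -/
def kron {n : ℕ} (i j : Fin n) : ℝ := if i = j then 1 else 0

/-- `∑_{i<j} V_ij(q_i - q_j) dq_i ∧ dq_j ∧ (dp_i + dp_j)`. -/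
def potDN {n : ℕ} (V : Fin n → Fin n → ℝ → ℝ) : Form (Idx n) 3 := fun x =>
  ∑ i, ∑ j ∈ Finset.Ioi i, V i j (x (qIdx i) - x (qIdx j)) •
    (wedge₃ (qIdx i) (qIdx j) (pIdx i) + wedge₃ (qIdx i) (qIdx j) (pIdx j))

/-- `2 ∑_{i<j} V_ij'(q_i - q_j) dq_i ∧ dq_j ∧
∑_{k<l} ((δ_il - δ_jl) dp_k + (δ_jk - δ_ik) dp_l)`. -/
def potKoszul {n : ℕ} (V : Fin n → Fin n → ℝ → ℝ) : Form (Idx n) 3 := fun x =>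
  (2 : ℝ) • ∑ i, ∑ j ∈ Finset.Ioi i, deriv (V i j) (x (qIdx i) - x (qIdx j)) •
    ∑ k, ∑ l ∈ Finset.Ioi k,
      ((kron i l - kron j l) • wedge₃ (qIdx i) (qIdx j) (pIdx k)
        + (kron j k - kron i k) • wedge₃ (qIdx i) (qIdx j) (pIdx l))

/-! ### The Toda lattices with `n = m + 2` particles -/

/-- The Toda potentials `V_{i,i+1}(t) = f_i e^t` for consecutive particles and
`V_{1n}(t) = f_n e^{-t}` for the pair (first, last), the others being zero. For two particles both
terms contribute to the only potential. Particles are numbered from `0` here. -/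
def todaV {m : ℕ} (f : Fin (m + 2) → ℝ) (i j : Fin (m + 2)) (t : ℝ) : ℝ :=
  (if i.val + 1 = j.val then f i * Real.exp t else 0)
    + (if i = 0 ∧ j = Fin.last (m + 1) then f (Fin.last (m + 1)) * Real.exp (-t) else 0)

/-- The Das–Okubo tensor field of the open Toda lattice, with coupling constants `g_i`:
`∑ p_i (∂_{q_i} ⊗ dq_i + ∂_{p_i} ⊗ dp_i) + ∑_{i<j} (∂_{q_i} ⊗ dp_j - ∂_{q_j} ⊗ dp_i)
+ ∑_{i=1}^{n-1} g_i e^{q_i - q_{i+1}} (∂_{p_{i+1}} ⊗ dq_i - ∂_{p_i} ⊗ dq_{i+1})`. -/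
def dasOkuboN {m : ℕ} (g : Fin (m + 1) → ℝ) : EndoField (Idx (m + 2)) := fun x =>
  ∑ i : Fin (m + 2), x (pIdx i) • (tens (qIdx i) (qIdx i) + tens (pIdx i) (pIdx i))
    + ∑ i : Fin (m + 2), ∑ j ∈ Finset.Ioi i, (tens (qIdx i) (pIdx j) - tens (qIdx j) (pIdx i))
    + ∑ i : Fin (m + 1), (g i * Real.exp (x (qIdx i.castSucc) - x (qIdx i.succ))) •
        (tens (pIdx i.succ) (qIdx i.castSucc) - tens (pIdx i.castSucc) (qIdx i.succ))

/-- The tensor field with coupling constants `f_1, …, f_n`: the Das–Okubo tensor field with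
constants `f_1, …, f_{n-1}`, minus `f_n e^{q_n - q_1} (∂_{p_1} ⊗ dq_n - ∂_{p_n} ⊗ dq_1)`. -/
def todaN {m : ℕ} (f : Fin (m + 2) → ℝ) : EndoField (Idx (m + 2)) := fun x =>
  dasOkuboN (fun i => f i.castSucc) x
    - (f (Fin.last (m + 1)) * Real.exp (x (qIdx (Fin.last (m + 1))) - x (qIdx 0))) •
        (tens (pIdx 0) (qIdx (Fin.last (m + 1))) - tens (pIdx (Fin.last (m + 1))) (qIdx 0))

/-- `2 f_n e^{q_n - q_1} dq_1 ∧ dq_n ∧ ∑ dp_i`. -/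
def todaForm {m : ℕ} (f : Fin (m + 2) → ℝ) : Form (Idx (m + 2)) 3 := fun x =>
  (2 * f (Fin.last (m + 1)) * Real.exp (x (qIdx (Fin.last (m + 1))) - x (qIdx 0))) •
    ∑ i, wedge₃ (qIdx 0) (qIdx (Fin.last (m + 1))) (pIdx i)

/-- The tensor field of the closed Toda lattice. -/
def closedTodaN (m : ℕ) : EndoField (Idx (m + 2)) := fun x =>
  ∑ i : Fin (m + 2), x (pIdx i) • (tens (qIdx i) (qIdx i) + tens (pIdx i) (pIdx i))
    + ∑ i : Fin (m + 2), ∑ j ∈ Finset.Ioi i, (tens (qIdx i) (pIdx j) - tens (qIdx j) (pIdx i))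
    + ∑ i : Fin (m + 1), Real.exp (x (qIdx i.castSucc) - x (qIdx i.succ)) •
        (tens (pIdx i.succ) (qIdx i.castSucc) - tens (pIdx i.castSucc) (qIdx i.succ))
    - Real.exp (x (qIdx (Fin.last (m + 1))) - x (qIdx 0)) •
        (tens (pIdx 0) (qIdx (Fin.last (m + 1))) - tens (pIdx (Fin.last (m + 1))) (qIdx 0))

/-- The 3-form `2 e^{q_n - q_1} dq_1 ∧ dq_n ∧ ∑ dp_i` of the closed Toda lattice. -/
def closedTodaForm (m : ℕ) : Form (Idx (m + 2)) 3 := fun x =>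
  (2 * Real.exp (x (qIdx (Fin.last (m + 1))) - x (qIdx 0))) •
    ∑ i, wedge₃ (qIdx 0) (qIdx (Fin.last (m + 1))) (pIdx i)

end

end PqN

open PqN

/-!
For a bivector `π` with constant coefficients and a closed 2-form `Ω`, the tensor field
`N = π♯ Ω♭` (`sharpFlat`) satisfies, for every covector `α`, `⟨α, N v⟩ = Ω (π♯ α, v)`; hence its
derivatives are those of `Ω`. All the axioms of a Poisson quasi-Nijenhuis structure are then
linear consequences of `dΩ = 0`, the 3-form being
`φ (X, Y, Z) = D_{NX} Ω (Y, Z) + D_{NY} Ω (Z, X) + D_{NZ} Ω (X, Y)` (`isPqN_sharpFlat`). Closedness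
of `φ` and of `i_N φ` costs nothing, because both are exact: `φ = -½ d (i_N Ω)`, which is the
definition of `torsionForm`, and `i_N φ = -¼ d (i_N i_N Ω)` (`insertN_torsionForm`).

The tensor field `∑ p_i (∂_{q_i} ⊗ dq_i + ∂_{p_i} ⊗ dp_i)` is itself of this kind, with
`Ω₀ = ∑ p_i dq_i ∧ dp_i` (`canonicalN_eq`), and its 3-form vanishes. Deforming it by `π♯ Ω♭`
therefore amounts to replacing `Ω₀` by `Ω₀ + Ω`. The 3-form of `Ω₀ + Ω` is quadratic in
`Ω₀ + Ω`: its mixed part is `d_N Ω` and its part quadratic in `Ω` is `½ [Ω, Ω]_π`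
(`deformForm_sharpFlat`). The latter uses that for constant `π` the operator `Δ` is the divergence
`∑ₐ ι_{π♯ dxₐ} ∂ₐ` (`brylinski_const`), so that the Koszul bracket of `Ω` with itself is
`2 ∑ₐ ι_{π♯ dxₐ} Ω ∧ ∂ₐ Ω` (`koszul_self_apply`).

The explicit formulas follow by evaluating on vectors, pair of particles by pair of particles. For
the Toda potentials, `V' = V` on consecutive particles makes the two contributions to `φ` cancel,
while `V' = -V` on the pair (first, last) makes them add up.
-/

open scoped ContDiff

namespace PqN

/-! ### Wedge products evaluated on vectors -/

/-- Expansion of a signed sum over permutations according to the image of `0`. -/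
theorem sum_perm_succ {n : ℕ} (F : (Fin (n + 1) → Fin (n + 1)) → ℝ) :
    ∑ σ : Equiv.Perm (Fin (n + 1)), Equiv.Perm.sign σ • F σ
      = ∑ i : Fin (n + 1), (if i = 0 then (1 : ℝ) else -1) * ∑ τ : Equiv.Perm (Fin n),
          Equiv.Perm.sign τ • F (Fin.cons i fun j => Equiv.swap 0 i (τ j).succ) := by
  rw [← Equiv.sum_comp Equiv.Perm.decomposeFin.symm, Fintype.sum_prod_type]
  refine Finset.sum_congr rfl fun i _ => ?_
  rw [Finset.mul_sum]
  refine Finset.sum_congr rfl fun τ _ => ?_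
  have : ⇑(Equiv.Perm.decomposeFin.symm (i, τ))
      = Fin.cons i fun j => Equiv.swap 0 i (τ j).succ := by
    funext j
    refine Fin.cases ?_ (fun j => ?_) j <;> simp
  rw [this, Equiv.Perm.decomposeFin.symm_sign]
  split_ifs <;> simp [Units.smul_def]

theorem sum_perm_two (F : (Fin 2 → Fin 2) → ℝ) :
    ∑ σ : Equiv.Perm (Fin 2), Equiv.Perm.sign σ • F σ = F ![0, 1] - F ![1, 0] := by
  have h1 : (⇑(1 : Equiv.Perm (Fin 2)) : Fin 2 → Fin 2) = ![0, 1] := by decide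
  have h2 : (⇑(Equiv.swap (0 : Fin 2) 1) : Fin 2 → Fin 2) = ![1, 0] := by decide
  have h3 : (Finset.univ : Finset (Equiv.Perm (Fin 2))) = {1, Equiv.swap 0 1} := by decide
  rw [h3, Finset.sum_pair (by decide), h1, h2]
  simp [sub_eq_add_neg]

theorem sum_perm_three (F : (Fin 3 → Fin 3) → ℝ) :
    ∑ σ : Equiv.Perm (Fin 3), Equiv.Perm.sign σ • F σ
      = F ![0, 1, 2] - F ![0, 2, 1] - F ![1, 0, 2] + F ![1, 2, 0] + F ![2, 0, 1]
        - F ![2, 1, 0] := by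
  have h (i a b c : Fin 3) (τ : Fin 2 → Fin 2)
      (h : (Fin.cons i fun j => Equiv.swap 0 i (τ j).succ : Fin 3 → Fin 3) = ![a, b, c]) :
      F (Fin.cons i fun j => Equiv.swap 0 i (τ j).succ) = F ![a, b, c] := by rw [h]
  have k (i : Fin 3) :=
    sum_perm_two fun τ => F (Fin.cons i fun j => Equiv.swap 0 i (τ j).succ)
  rw [sum_perm_succ, Fin.sum_univ_three, k 0, k 1, k 2]
  rw [h 0 0 1 2 _ (by decide), h 0 0 2 1 _ (by decide), h 1 1 0 2 _ (by decide),
    h 1 1 2 0 _ (by decide), h 2 2 1 0 _ (by decide), h 2 2 0 1 _ (by decide)]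
  simp
  ring

theorem sum_perm_four (F : (Fin 4 → Fin 4) → ℝ) :
    ∑ σ : Equiv.Perm (Fin 4), Equiv.Perm.sign σ • F σ
      = F ![0, 1, 2, 3] - F ![0, 1, 3, 2] - F ![0, 2, 1, 3] + F ![0, 2, 3, 1]
        + F ![0, 3, 1, 2] - F ![0, 3, 2, 1]
        - F ![1, 0, 2, 3] + F ![1, 0, 3, 2] + F ![1, 2, 0, 3] - F ![1, 2, 3, 0]
        - F ![1, 3, 0, 2] + F ![1, 3, 2, 0]
        + F ![2, 0, 1, 3] - F ![2, 0, 3, 1] - F ![2, 1, 0, 3] + F ![2, 1, 3, 0]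
        + F ![2, 3, 0, 1] - F ![2, 3, 1, 0]
        - F ![3, 0, 1, 2] + F ![3, 0, 2, 1] + F ![3, 1, 0, 2] - F ![3, 1, 2, 0]
        - F ![3, 2, 0, 1] + F ![3, 2, 1, 0] := by
  have h (i a b c d : Fin 4) (τ : Fin 3 → Fin 3)
      (h : (Fin.cons i fun j => Equiv.swap 0 i (τ j).succ : Fin 4 → Fin 4) = ![a, b, c, d]) :
      F (Fin.cons i fun j => Equiv.swap 0 i (τ j).succ) = F ![a, b, c, d] := by rw [h]
  have k (i : Fin 4) :=
    sum_perm_three fun τ => F (Fin.cons i fun j => Equiv.swap 0 i (τ j).succ)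
  rw [sum_perm_succ, Fin.sum_univ_four, k 0, k 1, k 2, k 3]
  rw [h 0 0 1 2 3 _ (by decide), h 0 0 1 3 2 _ (by decide), h 0 0 2 1 3 _ (by decide),
    h 0 0 2 3 1 _ (by decide), h 0 0 3 1 2 _ (by decide), h 0 0 3 2 1 _ (by decide),
    h 1 1 0 2 3 _ (by decide), h 1 1 0 3 2 _ (by decide), h 1 1 2 0 3 _ (by decide),
    h 1 1 2 3 0 _ (by decide), h 1 1 3 0 2 _ (by decide), h 1 1 3 2 0 _ (by decide),
    h 2 2 1 0 3 _ (by decide), h 2 2 1 3 0 _ (by decide), h 2 2 0 1 3 _ (by decide),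
    h 2 2 0 3 1 _ (by decide), h 2 2 3 1 0 _ (by decide), h 2 2 3 0 1 _ (by decide),
    h 3 3 1 2 0 _ (by decide), h 3 3 1 0 2 _ (by decide), h 3 3 2 1 0 _ (by decide),
    h 3 3 2 0 1 _ (by decide), h 3 3 0 1 2 _ (by decide), h 3 3 0 2 1 _ (by decide)]
  simp
  ring

section Wedge

variable {V : Type*} [NormedAddCommGroup V] [NormedSpace ℝ V]

theorem form_swap (β : V [⋀^Fin 2]→L[ℝ] ℝ) (u v : V) : β ![v, u] = -β ![u, v] := by
  have h := β.toAlternatingMap.map_swap ![u, v] (i := 0) (j := 1) (by decide)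
  change β _ = -β _ at h
  rw [← h]
  congr 1
  funext i
  fin_cases i <;> rfl

@[simp] theorem covec_apply (α : V →L[ℝ] ℝ) (u : V) : covec α ![u] = α u := rfl

theorem wedge_one_one (α β : V [⋀^Fin 1]→L[ℝ] ℝ) (u v : V) :
    wedge α β ![u, v] = α ![u] * β ![v] - α ![v] * β ![u] := by
  have key (σ : Fin 2 → Fin 2) :
      α (fun i => ![u, v] (σ (Fin.castAdd 1 i))) * β (fun i => ![u, v] (σ (Fin.natAdd 1 i)))
        = α ![![u, v] (σ 0)] * β ![![u, v] (σ 1)] := by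
    congr 2 <;> funext i <;> fin_cases i <;> rfl
  rw [wedge_apply]
  change _ * ∑ σ : Equiv.Perm (Fin 2), _ = _
  simp only [key]
  rw [sum_perm_two fun σ => α ![![u, v] (σ 0)] * β ![![u, v] (σ 1)]]
  simp

theorem wedge_two_one (β : V [⋀^Fin 2]→L[ℝ] ℝ) (α : V [⋀^Fin 1]→L[ℝ] ℝ) (u v w : V) :
    wedge β α ![u, v, w]
      = β ![u, v] * α ![w] + β ![v, w] * α ![u] + β ![w, u] * α ![v] := by
  have key (σ : Fin 3 → Fin 3) :
      β (fun i => ![u, v, w] (σ (Fin.castAdd 1 i))) * α (fun i => ![u, v, w] (σ (Fin.natAdd 2 i)))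
        = β ![![u, v, w] (σ 0), ![u, v, w] (σ 1)] * α ![![u, v, w] (σ 2)] := by
    congr 2 <;> funext i <;> fin_cases i <;> rfl
  rw [wedge_apply]
  change _ * ∑ σ : Equiv.Perm (Fin 3), _ = _
  simp only [key]
  rw [sum_perm_three fun σ => β ![![u, v, w] (σ 0), ![u, v, w] (σ 1)] * α ![![u, v, w] (σ 2)]]
  simp [form_swap β v u, form_swap β w v, form_swap β w u]
  ring

theorem wedge_one_two (α : V [⋀^Fin 1]→L[ℝ] ℝ) (β : V [⋀^Fin 2]→L[ℝ] ℝ) (u v w : V) :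
    wedge α β ![u, v, w]
      = α ![u] * β ![v, w] + α ![v] * β ![w, u] + α ![w] * β ![u, v] := by
  have key (σ : Fin 3 → Fin 3) :
      α (fun i => ![u, v, w] (σ (Fin.castAdd 2 i))) * β (fun i => ![u, v, w] (σ (Fin.natAdd 1 i)))
        = α ![![u, v, w] (σ 0)] * β ![![u, v, w] (σ 1), ![u, v, w] (σ 2)] := by
    congr 2 <;> funext i <;> fin_cases i <;> rfl
  rw [wedge_apply]
  change _ * ∑ σ : Equiv.Perm (Fin 3), _ = _
  simp only [key]
  rw [sum_perm_three fun σ => α ![![u, v, w] (σ 0)] * β ![![u, v, w] (σ 1), ![u, v, w] (σ 2)]]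
  simp [form_swap β v u, form_swap β w v, form_swap β w u]
  ring

theorem wedge_two_two (α β : V [⋀^Fin 2]→L[ℝ] ℝ) (t u v w : V) :
    wedge α β ![t, u, v, w]
      = α ![t, u] * β ![v, w] + α ![t, v] * β ![w, u] + α ![t, w] * β ![u, v]
        + α ![u, v] * β ![t, w] + α ![v, w] * β ![t, u] + α ![w, u] * β ![t, v] := by
  have key (σ : Fin 4 → Fin 4) :
      α (fun i => ![t, u, v, w] (σ (Fin.castAdd 2 i)))
          * β (fun i => ![t, u, v, w] (σ (Fin.natAdd 2 i)))
        = α ![![t, u, v, w] (σ 0), ![t, u, v, w] (σ 1)]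
          * β ![![t, u, v, w] (σ 2), ![t, u, v, w] (σ 3)] := by
    congr 2 <;> funext i <;> fin_cases i <;> rfl
  rw [wedge_apply]
  change _ * ∑ σ : Equiv.Perm (Fin 4), _ = _
  simp only [key]
  rw [sum_perm_four fun σ => α ![![t, u, v, w] (σ 0), ![t, u, v, w] (σ 1)]
          * β ![![t, u, v, w] (σ 2), ![t, u, v, w] (σ 3)]]
  simp [form_swap _ t u, form_swap _ t v, form_swap _ t w, form_swap _ u v, form_swap _ u w,
    form_swap _ v w]
  ring

end Wedge

/-! ### Smooth families of alternating forms, and the exterior derivative -/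

section Smooth

variable {E V : Type*} [NormedAddCommGroup E] [NormedSpace ℝ E] [NormedAddCommGroup V]
  [NormedSpace ℝ V] {k l : ℕ}

/-- On a finite-dimensional space, smoothness of a field of alternating forms can be checked by
evaluating the forms on constant vectors: a form is recovered linearly from its values on tuples
of basis vectors. -/
theorem contDiff_form_of_apply [FiniteDimensional ℝ V] {m : WithTop ℕ∞}
    {f : E → V [⋀^Fin k]→L[ℝ] ℝ} (h : ∀ v, ContDiff ℝ m fun x => f x v) : ContDiff ℝ m f := by
  let b := Module.finBasis ℝ V
  let L : (V [⋀^Fin k]→L[ℝ] ℝ) →ₗ[ℝ] ((Fin k → Fin (Module.finrank ℝ V)) → ℝ) :=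
    { toFun := fun α s => α fun i => b (s i)
      map_add' := fun _ _ => rfl
      map_smul' := fun _ _ => rfl }
  have hL : LinearMap.ker L = ⊥ := by
    refine LinearMap.ker_eq_bot.2 fun α β hαβ => ?_
    apply ContinuousAlternatingMap.toAlternatingMap_injective
    exact Module.Basis.ext_alternating b fun s _ => congrFun hαβ s
  obtain ⟨G, hG⟩ := LinearMap.exists_leftInverse_of_injective L hL
  have hf : f = fun x => LinearMap.toContinuousLinearMap G (L (f x)) :=
    funext fun x => (LinearMap.congr_fun hG (f x)).symm
  rw [hf]
  exact (ContinuousLinearMap.contDiff _).comp (contDiff_pi.2 fun s => h _)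

theorem contDiff_form_apply {m : WithTop ℕ∞} {f : E → V [⋀^Fin k]→L[ℝ] ℝ} (h : ContDiff ℝ m f)
    (v : Fin k → V) : ContDiff ℝ m fun x => f x v :=
  (ContinuousAlternatingMap.apply ℝ V ℝ v).contDiff.comp h

theorem fderiv_form_apply {f : E → V [⋀^Fin k]→L[ℝ] ℝ} {x : E} (h : DifferentiableAt ℝ f x)
    (u : E) (v : Fin k → V) : fderiv ℝ f x u v = fderiv ℝ (fun y => f y v) x u :=
  (fderiv_continuousAlternatingMap_apply_const_apply h v u).symm

theorem contDiff_wedge [FiniteDimensional ℝ V] {m : WithTop ℕ∞}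
    {α : E → V [⋀^Fin k]→L[ℝ] ℝ} {β : E → V [⋀^Fin l]→L[ℝ] ℝ} (hα : ContDiff ℝ m α)
    (hβ : ContDiff ℝ m β) : ContDiff ℝ m fun x => wedge (α x) (β x) := by
  refine contDiff_form_of_apply fun v => ?_
  simp only [wedge_apply, Units.smul_def, zsmul_eq_mul]
  refine contDiff_const.mul (ContDiff.sum fun σ _ => contDiff_const.mul ?_)
  exact (contDiff_form_apply hα _).mul (contDiff_form_apply hβ _)

theorem fderiv_wedge [FiniteDimensional ℝ V]
    {α : E → V [⋀^Fin k]→L[ℝ] ℝ} {β : E → V [⋀^Fin l]→L[ℝ] ℝ} (hα : ContDiff ℝ 1 α)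
    (hβ : ContDiff ℝ 1 β) (x u : E) :
    fderiv ℝ (fun x => wedge (α x) (β x)) x u
      = wedge (fderiv ℝ α x u) (β x) + wedge (α x) (fderiv ℝ β x u) := by
  have hα' := (hα.differentiable one_ne_zero).differentiableAt (x := x)
  have hβ' := (hβ.differentiable one_ne_zero).differentiableAt (x := x)
  ext v
  rw [fderiv_form_apply ((contDiff_wedge hα hβ).differentiable one_ne_zero).differentiableAt]
  simp only [wedge_apply, Units.smul_def, zsmul_eq_mul, ContinuousAlternatingMap.add_apply]
  have h (σ : Equiv.Perm (Fin (k + l))) := 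
    (((contDiff_form_apply hα fun i => v (σ (Fin.castAdd l i))).differentiable
      one_ne_zero).differentiableAt (x := x)).hasFDerivAt.fun_mul
    (((contDiff_form_apply hβ fun i => v (σ (Fin.natAdd k i))).differentiable
      one_ne_zero).differentiableAt (x := x)).hasFDerivAt
  rw [((HasFDerivAt.fun_sum fun σ _ => (h σ).const_mul _).const_mul _).fderiv]
  simp [fderiv_form_apply hα', fderiv_form_apply hβ', ← mul_add, ← Finset.sum_add_distrib]
  left
  refine Finset.sum_congr rfl fun σ _ => ?_
  ring
end Smooth

section ExteriorDerivative

variable {ι : Type} [Fintype ι]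

/-- Unlike `extDeriv_apply`, this takes the derivative before evaluating, so that no
differentiability is needed. -/
theorem extDeriv_eq_sum {k : ℕ} (α : Form ι k) (x : ι → ℝ) (v : Fin (k + 1) → ι → ℝ) :
    extDeriv α x v
      = ∑ i : Fin (k + 1), (-1 : ℝ) ^ (i : ℕ) * fderiv ℝ α x (v i) (i.removeNth v) := by
  rw [extDeriv, ContinuousAlternatingMap.alternatizeUncurryFin_apply]
  simp [zsmul_eq_mul]

theorem extDeriv_one_form (α : Form ι 1) (x u v : ι → ℝ) :
    extDeriv α x ![u, v] = fderiv ℝ α x u ![v] - fderiv ℝ α x v ![u] := by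
  have h0 : (0 : Fin 2).removeNth ![u, v] = ![v] := by ext i; fin_cases i; rfl
  have h1 : (1 : Fin 2).removeNth ![u, v] = ![u] := by ext i; fin_cases i; rfl
  rw [extDeriv_eq_sum, Fin.sum_univ_two, h0, h1]
  simp
  ring

theorem extDeriv_two_form (α : Form ι 2) (x u v w : ι → ℝ) :
    extDeriv α x ![u, v, w]
      = fderiv ℝ α x u ![v, w] + fderiv ℝ α x v ![w, u] + fderiv ℝ α x w ![u, v] := by
  have h0 : (0 : Fin 3).removeNth ![u, v, w] = ![v, w] := by ext i; fin_cases i <;> rfl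
  have h1 : (1 : Fin 3).removeNth ![u, v, w] = ![u, w] := by ext i; fin_cases i <;> rfl
  have h2 : (2 : Fin 3).removeNth ![u, v, w] = ![u, v] := by ext i; fin_cases i <;> rfl
  rw [extDeriv_eq_sum, Fin.sum_univ_three, h0, h1, h2, form_swap _ u w]
  simp

end ExteriorDerivative

/-! ### Constant bivectors and the tensor fields `π♯ Ω♭` -/

section Ext

variable {V : Type*} [NormedAddCommGroup V] [NormedSpace ℝ V]

theorem form_two_ext {α β : V [⋀^Fin 2]→L[ℝ] ℝ} (h : ∀ u v, α ![u, v] = β ![u, v]) :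
    α = β := by
  ext v
  have : v = ![v 0, v 1] := by ext i; fin_cases i <;> rfl
  rw [this]
  exact h _ _

theorem form_three_ext {α β : V [⋀^Fin 3]→L[ℝ] ℝ}
    (h : ∀ u v w, α ![u, v, w] = β ![u, v, w]) : α = β := by
  ext v
  have : v = ![v 0, v 1, v 2] := by ext i; fin_cases i <;> rfl
  rw [this]
  exact h _ _ _

end Ext

section Covectors

variable {ι : Type} [Fintype ι]

theorem apply_eq_sum [DecidableEq ι] {F : Type*} [NormedAddCommGroup F] [NormedSpace ℝ F]
    (L : (ι → ℝ) →L[ℝ] F) (w : ι → ℝ) : L w = ∑ a, w a • L (basisVec a) := by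
  conv_lhs => rw [pi_eq_sum_univ' w, map_sum]
  simp [basisVec]

theorem covector_eq_sum [DecidableEq ι] (α : (ι → ℝ) →L[ℝ] ℝ) :
    α = ∑ a, α (basisVec a) • dx a := by
  ext w
  rw [apply_eq_sum α w, _root_.sum_apply]
  exact Finset.sum_congr rfl fun a _ => mul_comm _ _

/-- Linearity of an alternating form in one slot, expanded in the coordinate basis. -/
theorem form_update_eq_sum [DecidableEq ι] {k : ℕ} (α : (ι → ℝ) [⋀^Fin k]→L[ℝ] ℝ)
    (v : Fin k → ι → ℝ) (i : Fin k) (w : ι → ℝ) :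
    α (Function.update v i w) = ∑ a, w a * α (Function.update v i (basisVec a)) :=
  apply_eq_sum (α.toContinuousLinearMap v i) w

end Covectors

section ConstantBivector

variable {ι : Type} [Fintype ι] (P : ((ι → ℝ) →L[ℝ] ℝ) [⋀^Fin 2]→L[ℝ] ℝ)

/-- The map `π♯` of a bivector with constant coefficients, which is the same at every point; it is
taken at the origin. -/
noncomputable def constSharp : ((ι → ℝ) →L[ℝ] ℝ) →L[ℝ] (ι → ℝ) := sharp (fun _ => P) 0

theorem sharp_const (x : ι → ℝ) : sharp (fun _ => P) x = constSharp P := rfl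

theorem apply_constSharp (α β : (ι → ℝ) →L[ℝ] ℝ) : β (constSharp P α) = P ![α, β] := by
  classical
  have h (γ : (ι → ℝ) →L[ℝ] ℝ) : P.toContinuousLinearMap ![α, 0] 1 γ = P ![α, γ] := by
    change P (Function.update ![α, 0] 1 γ) = _
    congr 1
    funext i
    fin_cases i <;> rfl
  rw [← h, covector_eq_sum β, map_sum, _root_.sum_apply]
  refine Finset.sum_congr rfl fun a _ => ?_
  rw [map_smul, h, _root_.smul_apply]
  congr 1
  exact sharp_apply (fun _ => P) 0 α a

theorem apply_constSharp_symm (α β : (ι → ℝ) →L[ℝ] ℝ) :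
    β (constSharp P α) = -α (constSharp P β) := by
  rw [apply_constSharp, apply_constSharp, form_swap]

/-- The `(1,1)` tensor field `π♯ Ω♭`, for a constant bivector `π`. -/
noncomputable def sharpFlat (Ω : Form ι 2) : EndoField ι := fun x => (constSharp P).comp (flat Ω x)

theorem apply_sharpFlat (Ω : Form ι 2) (x v : ι → ℝ) (α : (ι → ℝ) →L[ℝ] ℝ) :
    α (sharpFlat P Ω x v) = Ω x ![constSharp P α, v] := by
  change α (constSharp P (flat Ω x v)) = _
  rw [apply_constSharp_symm, flat_apply, form_swap, neg_neg]

/-- Moving `π♯` across a pairing exchanges the two forms. For `Ω₁ = Ω₂` this says that `π♯ Ω♭` is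
symmetric with respect to `Ω`. -/
theorem form_sharpFlat (Ω₁ Ω₂ : Form ι 2) (x u v : ι → ℝ) :
    Ω₂ x ![u, sharpFlat P Ω₁ x v] = Ω₁ x ![sharpFlat P Ω₂ x u, v] := by
  rw [← flat_apply, apply_sharpFlat]
  rfl

theorem sharpFlat_eq_sum [DecidableEq ι] (Ω : Form ι 2) (x v : ι → ℝ) :
    sharpFlat P Ω x v = fun a => Ω x ![constSharp P (dx a), v] :=
  funext fun a => apply_sharpFlat P Ω x v (dx a)

variable {P}

theorem contDiff_sharpFlat {m : WithTop ℕ∞} {Ω : Form ι 2} (hΩ : ContDiff ℝ m Ω) :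
    ContDiff ℝ m (sharpFlat P Ω) := by
  classical
  refine contDiff_clm_apply_iff.2 fun v => contDiff_pi.2 fun a => ?_
  simp only [sharpFlat_eq_sum]
  exact contDiff_form_apply hΩ _

/-- The derivative of `π♯ Ω♭` is that of `Ω`, because `π` is constant. -/
theorem apply_fderiv_sharpFlat {Ω : Form ι 2} (hΩ : ContDiff ℝ 1 Ω) (x u v : ι → ℝ)
    (α : (ι → ℝ) →L[ℝ] ℝ) :
    α (fderiv ℝ (sharpFlat P Ω) x u v) = fderiv ℝ Ω x u ![constSharp P α, v] := by
  have hN := ((contDiff_sharpFlat (P := P) hΩ).differentiable one_ne_zero).differentiableAt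
    (x := x)
  have hΩ' := (hΩ.differentiable one_ne_zero).differentiableAt (x := x)
  rw [fderiv_form_apply hΩ']
  have h : (fun y => Ω y ![constSharp P α, v]) = fun y => α (sharpFlat P Ω y v) :=
    funext fun y => (apply_sharpFlat P Ω y v α).symm
  rw [h]
  have h1 := (hN.hasFDerivAt.clm_apply (hasFDerivAt_const v x))
  rw [HasFDerivAt.fderiv (f := fun y => α (sharpFlat P Ω y v)) (α.hasFDerivAt.comp x h1)]
  simp

theorem form_fderiv_sharpFlat {Ω₁ : Form ι 2} (h₁ : ContDiff ℝ 1 Ω₁) (Ω₂ : Form ι 2)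
    (x w u v : ι → ℝ) :
    Ω₂ x ![u, fderiv ℝ (sharpFlat P Ω₁) x w v] = fderiv ℝ Ω₁ x w ![sharpFlat P Ω₂ x u, v] := by
  rw [← flat_apply, apply_fderiv_sharpFlat h₁]
  rfl

end ConstantBivector

section InsertN

variable {ι : Type} [Fintype ι] {k : ℕ} {m : WithTop ℕ∞} {N : EndoField ι} {α : Form ι k}

theorem insertN_apply_eq_sum [DecidableEq ι] (N : EndoField ι) (α : Form ι k) (x : ι → ℝ)
    (v : Fin k → ι → ℝ) :
    insertN N α x v
      = ∑ i, ∑ a, N x (v i) a * α x (Function.update v i (basisVec a)) := by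
  rw [insertN, insertEndo_apply]
  exact Finset.sum_congr rfl fun i _ => form_update_eq_sum _ _ _ _

theorem contDiff_insertN (hN : ContDiff ℝ m N) (hα : ContDiff ℝ m α) :
    ContDiff ℝ m (insertN N α) := by
  classical
  refine contDiff_form_of_apply fun v => ?_
  simp only [insertN_apply_eq_sum]
  refine ContDiff.sum fun i _ => ContDiff.sum fun a _ => ContDiff.mul ?_ ?_
  · exact contDiff_pi.1 (hN.clm_apply contDiff_const) a
  · exact contDiff_form_apply hα _

/-- The product rule for `i_N α`. -/
theorem fderiv_insertN (hN : ContDiff ℝ 1 N) (hα : ContDiff ℝ 1 α) (x u : ι → ℝ) :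
    fderiv ℝ (insertN N α) x u
      = insertEndo (fderiv ℝ N x u) (α x) + insertEndo (N x) (fderiv ℝ α x u) := by
  classical
  have hN' := (hN.differentiable one_ne_zero).differentiableAt (x := x)
  have hα' := (hα.differentiable one_ne_zero).differentiableAt (x := x)
  ext v
  rw [fderiv_form_apply ((contDiff_insertN hN hα).differentiable one_ne_zero).differentiableAt]
  simp only [insertN_apply_eq_sum, ContinuousAlternatingMap.add_apply, insertEndo_apply]
  have h1 (i : Fin k) (a : ι) :=
    (hasFDerivAt_pi'.1 (hN'.hasFDerivAt.clm_apply (hasFDerivAt_const (v i) x)) a)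
  have h2 (i : Fin k) (a : ι) := ((contDiff_form_apply hα
    (Function.update v i (basisVec a))).differentiable one_ne_zero).differentiableAt
      (x := x) |>.hasFDerivAt
  rw [(HasFDerivAt.fun_sum fun i _ => HasFDerivAt.fun_sum fun a _ =>
    (h1 i a).fun_mul (h2 i a)).fderiv]
  rw [← Finset.sum_add_distrib, _root_.sum_apply]
  refine Finset.sum_congr rfl fun i _ => ?_
  rw [form_update_eq_sum, form_update_eq_sum, _root_.sum_apply, ← Finset.sum_add_distrib]
  refine Finset.sum_congr rfl fun a _ => ?_
  rw [fderiv_form_apply hα']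
  simp
  ring

theorem insertEndo_two (A : (ι → ℝ) →L[ℝ] (ι → ℝ)) (α : (ι → ℝ) [⋀^Fin 2]→L[ℝ] ℝ)
    (u v : ι → ℝ) : insertEndo A α ![u, v] = α ![A u, v] + α ![u, A v] := by
  have h0 (z : ι → ℝ) : Function.update ![u, v] 0 z = ![z, v] := by
    ext i; fin_cases i <;> rfl
  have h1 (z : ι → ℝ) : Function.update ![u, v] 1 z = ![u, z] := by
    ext i; fin_cases i <;> rfl
  rw [insertEndo_apply, Fin.sum_univ_two, h0, h1]
  rfl

theorem insertEndo_three (A : (ι → ℝ) →L[ℝ] (ι → ℝ)) (α : (ι → ℝ) [⋀^Fin 3]→L[ℝ] ℝ)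
    (u v w : ι → ℝ) :
    insertEndo A α ![u, v, w] = α ![A u, v, w] + α ![u, A v, w] + α ![u, v, A w] := by
  have h0 (z : ι → ℝ) : Function.update ![u, v, w] 0 z = ![z, v, w] := by
    ext i; fin_cases i <;> rfl
  have h1 (z : ι → ℝ) : Function.update ![u, v, w] 1 z = ![u, z, w] := by
    ext i; fin_cases i <;> rfl
  have h2 (z : ι → ℝ) : Function.update ![u, v, w] 2 z = ![u, v, z] := by
    ext i; fin_cases i <;> rfl
  rw [insertEndo_apply, Fin.sum_univ_three, h0, h1, h2]
  rfl

theorem contDiff_extDeriv {m m' : WithTop ℕ∞} {α : Form ι k} (hα : ContDiff ℝ m' α)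
    (hm : m + 1 ≤ m') : ContDiff ℝ m (extDeriv α) := by
  refine contDiff_form_of_apply fun v => ?_
  simp only [extDeriv_eq_sum]
  exact ContDiff.sum fun i _ => contDiff_const.mul
    (contDiff_form_apply ((hα.fderiv_right hm).clm_apply contDiff_const) _)

end InsertN

/-! ### The quasi-Nijenhuis structure of a closed 2-form -/

theorem vec_ext {ι : Type} {u v : ι → ℝ} (h : ∀ a, dx a u = dx a v) : u = v := funext h

section Closed

variable {ι : Type} [Fintype ι] {P : ((ι → ℝ) →L[ℝ] ℝ) [⋀^Fin 2]→L[ℝ] ℝ}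

/-- `dΩ = 0`, written as a cyclic sum of derivatives. -/
theorem closed_cyclic {Ω : Form ι 2} (hd : ∀ x, extDeriv Ω x = 0) (x u v w : ι → ℝ) :
    fderiv ℝ Ω x u ![v, w] + fderiv ℝ Ω x v ![w, u] + fderiv ℝ Ω x w ![u, v] = 0 := by
  rw [← extDeriv_two_form, hd]
  rfl

/-- For closed forms `Ω₁, Ω₂`, the form `d (i_{N₁} Ω₂)` is, up to sign, the polarisation of the
cyclic sum that computes the torsion of `π♯ Ω♭`; it is symmetric in `Ω₁` and `Ω₂`. -/
theorem extDeriv_insertN_sharpFlat {Ω₁ Ω₂ : Form ι 2} (h₁ : ContDiff ℝ 1 Ω₁)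
    (h₂ : ContDiff ℝ 1 Ω₂) (hd₁ : ∀ x, extDeriv Ω₁ x = 0) (hd₂ : ∀ x, extDeriv Ω₂ x = 0)
    (x u v w : ι → ℝ) :
    extDeriv (insertN (sharpFlat P Ω₁) Ω₂) x ![u, v, w]
      = -(fderiv ℝ Ω₂ x (sharpFlat P Ω₁ x u) ![v, w] + fderiv ℝ Ω₂ x (sharpFlat P Ω₁ x v) ![w, u]
          + fderiv ℝ Ω₂ x (sharpFlat P Ω₁ x w) ![u, v])
        - (fderiv ℝ Ω₁ x (sharpFlat P Ω₂ x u) ![v, w] + fderiv ℝ Ω₁ x (sharpFlat P Ω₂ x v) ![w, u]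
          + fderiv ℝ Ω₁ x (sharpFlat P Ω₂ x w) ![u, v]) := by
  have key (a b c : ι → ℝ) : fderiv ℝ (insertN (sharpFlat P Ω₁) Ω₂) x a ![b, c]
      = fderiv ℝ Ω₁ x a ![sharpFlat P Ω₂ x b, c] + fderiv ℝ Ω₁ x a ![b, sharpFlat P Ω₂ x c]
        + fderiv ℝ Ω₂ x a ![sharpFlat P Ω₁ x b, c]
        + fderiv ℝ Ω₂ x a ![b, sharpFlat P Ω₁ x c] := by
    rw [fderiv_insertN (contDiff_sharpFlat h₁) h₂, ContinuousAlternatingMap.add_apply,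
      insertEndo_two, insertEndo_two, form_fderiv_sharpFlat h₁, form_swap _ c,
      form_fderiv_sharpFlat h₁, form_swap _ b (sharpFlat P Ω₂ x c)]
    ring
  rw [extDeriv_two_form, key, key, key]
  -- Closedness of each form, with the other form's tensor field applied to one of the arguments.
  linarith [closed_cyclic hd₁ x u v (sharpFlat P Ω₂ x w),
    closed_cyclic hd₁ x v w (sharpFlat P Ω₂ x u),
    closed_cyclic hd₁ x w u (sharpFlat P Ω₂ x v), closed_cyclic hd₂ x u v (sharpFlat P Ω₁ x w),
    closed_cyclic hd₂ x v w (sharpFlat P Ω₁ x u), closed_cyclic hd₂ x w u (sharpFlat P Ω₁ x v)]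

/-- The 3-form `φ = -½ d (i_N Ω)` attached to `N = π♯ Ω♭`. For a closed form `Ω` it is half of
`d_N Ω`, and half of the Koszul bracket `[Ω, Ω]_π`. -/
noncomputable def torsionForm (P : ((ι → ℝ) →L[ℝ] ℝ) [⋀^Fin 2]→L[ℝ] ℝ) (Ω : Form ι 2) :
    Form ι 3 := fun x => (-(1 / 2) : ℝ) • extDeriv (insertN (sharpFlat P Ω) Ω) x

theorem torsionForm_apply {Ω : Form ι 2} (h : ContDiff ℝ 1 Ω) (hd : ∀ x, extDeriv Ω x = 0)
    (x u v w : ι → ℝ) :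
    torsionForm P Ω x ![u, v, w]
      = fderiv ℝ Ω x (sharpFlat P Ω x u) ![v, w] + fderiv ℝ Ω x (sharpFlat P Ω x v) ![w, u]
          + fderiv ℝ Ω x (sharpFlat P Ω x w) ![u, v] := by
  rw [torsionForm, ContinuousAlternatingMap.smul_apply, extDeriv_insertN_sharpFlat h h hd hd,
    smul_eq_mul]
  ring

theorem extDeriv_fun_const_smul {k : ℕ} (c : ℝ) (α : Form ι k) (x : ι → ℝ) :
    extDeriv (fun y => c • α y) x = c • extDeriv α x :=
  extDeriv_fun_smul c α

/-- `i_N φ = -¼ d (i_N (i_N Ω))`, whence `i_N φ` is closed. -/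
theorem insertN_torsionForm {Ω : Form ι 2} (h : ContDiff ℝ 2 Ω) (hd : ∀ x, extDeriv Ω x = 0) :
    insertN (sharpFlat P Ω) (torsionForm P Ω) = fun x => (-(1 / 4) : ℝ) •
      extDeriv (insertN (sharpFlat P Ω) (insertN (sharpFlat P Ω) Ω)) x := by
  have h1 : ContDiff ℝ 1 Ω := h.of_le one_le_two
  have hN : ContDiff ℝ 1 (sharpFlat P Ω) := contDiff_sharpFlat h1
  funext x
  set N := sharpFlat P Ω with hNdef
  have two (b c : ι → ℝ) : insertN N Ω x ![b, c] = 2 * Ω x ![b, N x c] := by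
    rw [insertN, insertEndo_two, ← form_sharpFlat P Ω Ω x b c]
    ring
  have key (a b c : ι → ℝ) : fderiv ℝ (insertN N Ω) x a ![b, c]
      = 2 * (fderiv ℝ Ω x a ![N x b, c] + fderiv ℝ Ω x a ![b, N x c]) := by
    rw [fderiv_insertN hN h1, ContinuousAlternatingMap.add_apply,
      insertEndo_two, insertEndo_two, form_fderiv_sharpFlat h1, form_swap _ c,
      form_fderiv_sharpFlat h1, form_swap _ b (N x c)]
    ring
  have key' (a b c : ι → ℝ) : fderiv ℝ (insertN N (insertN N Ω)) x a ![b, c]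
      = 4 * (fderiv ℝ Ω x a ![N x (N x b), c] + fderiv ℝ Ω x a ![N x b, N x c]
          + fderiv ℝ Ω x a ![b, N x (N x c)]) := by
    rw [fderiv_insertN hN (contDiff_insertN hN h1), ContinuousAlternatingMap.add_apply,
      insertEndo_two, insertEndo_two, key, key, form_swap _ c, two, two,
      form_sharpFlat P Ω Ω, form_sharpFlat P Ω Ω, form_fderiv_sharpFlat h1,
      form_fderiv_sharpFlat h1, form_swap _ b]
    ring
  refine form_three_ext fun u v w => ?_
  rw [insertN, insertEndo_three, torsionForm_apply h1 hd, torsionForm_apply h1 hd,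
    torsionForm_apply h1 hd, ContinuousAlternatingMap.smul_apply, extDeriv_two_form, key', key',
    key', smul_eq_mul, ← hNdef]
  -- Closedness on `(u, v, N² w)` and on `(u, N v, N w)`, and their cyclic permutations.
  linarith [closed_cyclic hd x u v (N x (N x w)), closed_cyclic hd x v w (N x (N x u)),
    closed_cyclic hd x w u (N x (N x v)), closed_cyclic hd x u (N x v) (N x w),
    closed_cyclic hd x v (N x w) (N x u), closed_cyclic hd x w (N x u) (N x v)]

theorem two_le_infty : (2 : WithTop ℕ∞) ≤ ∞ :=
  (mod_cast le_top : ((2 : ℕ∞) : WithTop ℕ∞) ≤ ∞)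

theorem isPoisson_const : IsPoisson (fun _ => P) where
  smooth := contDiff_const
  jacobi f g h hf hg hh x := by
    have brk (f g : (ι → ℝ) → ℝ) : poissonBracket (fun _ => P) f g
        = fun y => fderiv ℝ g y (constSharp P (fderiv ℝ f y)) := by
      funext y
      rw [apply_constSharp]
      rfl
    have hd {f : (ι → ℝ) → ℝ} (hf : ContDiff ℝ ∞ f) :
        HasFDerivAt (fderiv ℝ f) (fderiv ℝ (fderiv ℝ f) x) x :=
      ((hf.fderiv_right (m := 1) (by norm_cast)).differentiable
        one_ne_zero).differentiableAt.hasFDerivAt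
    have hs {f : (ι → ℝ) → ℝ} (hf : ContDiff ℝ ∞ f) (u v : ι → ℝ) :
        fderiv ℝ (fderiv ℝ f) x u v = fderiv ℝ (fderiv ℝ f) x v u :=
      (hf.contDiffAt.isSymmSndFDerivAt (by simpa using two_le_infty)) u v
    have br2 {f g : (ι → ℝ) → ℝ} (hf : ContDiff ℝ ∞ f) (hg : ContDiff ℝ ∞ g) (u : ι → ℝ) :
        fderiv ℝ (poissonBracket (fun _ => P) f g) x u
          = fderiv ℝ (fderiv ℝ g) x u (constSharp P (fderiv ℝ f x))
            - fderiv ℝ (fderiv ℝ f) x u (constSharp P (fderiv ℝ g x)) := by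
      rw [brk]
      have h1 := (hd hg).clm_apply
        (((constSharp P).hasFDerivAt (x := fderiv ℝ f x)).comp x (hd hf))
      have h2 := h1.fderiv
      simp only [Function.comp_apply] at h2
      rw [h2]
      simp [apply_constSharp_symm P (fderiv ℝ (fderiv ℝ f) x u)]
      ring
    -- The Jacobi sum consists of second derivatives, which cancel in pairs by symmetry.
    simp only [brk _ (poissonBracket _ _ _), br2 hf hg, br2 hg hh, br2 hh hf]
    rw [hs hf (constSharp P (fderiv ℝ g x)), hs hg (constSharp P (fderiv ℝ h x)),
      hs hh (constSharp P (fderiv ℝ f x))]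
    ring

/-- The torsion is tensorial: the derivatives of `X` and `Y` cancel. -/
theorem torsion_eq_fderiv {N : EndoField ι} (hN : ContDiff ℝ 1 N) {X Y : VField ι}
    (hX : ContDiff ℝ 1 X) (hY : ContDiff ℝ 1 Y) (x : ι → ℝ) :
    torsion N X Y x = fderiv ℝ N x (N x (X x)) (Y x) - fderiv ℝ N x (N x (Y x)) (X x)
      - N x (fderiv ℝ N x (X x) (Y x) - fderiv ℝ N x (Y x) (X x)) := by
  have hN' := (hN.differentiable one_ne_zero).differentiableAt (x := x) |>.hasFDerivAt
  have hX' := (hX.differentiable one_ne_zero).differentiableAt (x := x) |>.hasFDerivAt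
  have hY' := (hY.differentiable one_ne_zero).differentiableAt (x := x) |>.hasFDerivAt
  have h1 : fderiv ℝ (endoApply N X) x = _ := (hN'.clm_apply hX').fderiv
  have h2 : fderiv ℝ (endoApply N Y) x = _ := (hN'.clm_apply hY').fderiv
  simp only [torsion, bracket, VectorField.lieBracket, h1, h2, endoApply]
  simp only [_root_.add_apply, ContinuousLinearMap.comp_apply,
    ContinuousLinearMap.flip_apply, map_add, map_sub]
  abel

/-- The compatibility tensor involves no derivative of `α` or `X` once `N π♯ = π♯ N*`. -/
theorem concomitant_eq_fderiv {N : EndoField ι} (hN : ContDiff ℝ 1 N)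
    (hc : ∀ x (α : (ι → ℝ) →L[ℝ] ℝ), N x (constSharp P α) = constSharp P (α.comp (N x)))
    {α : CovectorField ι} {X : VField ι} (hα : ContDiff ℝ 1 α) (hX : ContDiff ℝ 1 X)
    (x : ι → ℝ) :
    lieEndo (sharpField (fun _ => P) α) N X x
        - sharp (fun _ => P) x (lieCovector X (transposeApply N α) x)
        + sharp (fun _ => P) x (lieCovector (endoApply N X) α x)
      = fderiv ℝ N x (constSharp P (α x)) (X x)
        - constSharp P ((α x).comp (fderiv ℝ N x (X x)))
        + constSharp P ((α x).comp ((fderiv ℝ N x).flip (X x))) := by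
  have hN' := (hN.differentiable one_ne_zero).differentiableAt (x := x) |>.hasFDerivAt
  have hX' := (hX.differentiable one_ne_zero).differentiableAt (x := x) |>.hasFDerivAt
  have hα' := (hα.differentiable one_ne_zero).differentiableAt (x := x) |>.hasFDerivAt
  have h1 : fderiv ℝ (endoApply N X) x = _ := (hN'.clm_apply hX').fderiv
  have h2 : fderiv ℝ (transposeApply N α) x = _ := (hα'.clm_comp hN').fderiv
  have h3 : fderiv ℝ (sharpField (fun _ => P) α) x = _ :=
    ((constSharp P).hasFDerivAt.comp x hα').fderiv
  simp only [lieEndo, bracket, VectorField.lieBracket, lieCovector, h1, h2, h3, sharp_const]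
  simp only [endoApply, sharpField, transposeApply, sharp_const]
  simp [hc, ContinuousLinearMap.comp_add, ContinuousLinearMap.comp_assoc]
  abel

theorem compatible_sharpFlat {Ω : Form ι 2} (h : ContDiff ℝ 1 Ω) (hd : ∀ x, extDeriv Ω x = 0) :
    Compatible (fun _ => P) (sharpFlat P Ω) := by
  have hc (x) (α : (ι → ℝ) →L[ℝ] ℝ) :
      sharpFlat P Ω x (constSharp P α) = constSharp P (α.comp (sharpFlat P Ω x)) := by
    refine vec_ext fun a => ?_
    rw [apply_sharpFlat, apply_constSharp_symm, ContinuousLinearMap.comp_apply, apply_sharpFlat,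
      form_swap]
  refine ⟨hc, fun α X hα hX x => ?_⟩
  rw [concomitant_eq_fderiv (contDiff_sharpFlat h) hc (hα.of_le (mod_cast le_top))
    (hX.of_le (mod_cast le_top))]
  refine vec_ext fun a => ?_
  have e (γ : (ι → ℝ) →L[ℝ] ℝ) := apply_constSharp_symm P γ (dx a)
  rw [map_zero, map_add, map_sub, apply_fderiv_sharpFlat h, e, e]
  simp only [ContinuousLinearMap.comp_apply, ContinuousLinearMap.flip_apply,
    apply_fderiv_sharpFlat h]
  linarith [closed_cyclic hd x (constSharp P (α x)) (constSharp P (dx a)) (X x),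
    form_swap (fderiv ℝ Ω x (constSharp P (α x))) (constSharp P (dx a)) (X x),
    form_swap (fderiv ℝ Ω x (constSharp P (dx a))) (constSharp P (α x)) (X x)]

theorem torsion_sharpFlat {Ω : Form ι 2} (h : ContDiff ℝ 1 Ω) (hd : ∀ x, extDeriv Ω x = 0)
    {X Y : VField ι} (hX : ContDiff ℝ 1 X) (hY : ContDiff ℝ 1 Y) (x : ι → ℝ) :
    torsion (sharpFlat P Ω) X Y x
      = sharp (fun _ => P) x (contract₂ (torsionForm P Ω) X Y x) := by
  rw [torsion_eq_fderiv (contDiff_sharpFlat h) hX hY, sharp_const]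
  refine vec_ext fun a => ?_
  rw [apply_constSharp_symm, contract₂_apply, torsionForm_apply h hd, map_sub, map_sub,
    apply_fderiv_sharpFlat h, apply_fderiv_sharpFlat h, apply_sharpFlat]
  rw [← flat_apply Ω, map_sub, flat_apply, flat_apply, form_fderiv_sharpFlat h,
    form_fderiv_sharpFlat h]
  linarith [closed_cyclic hd x (X x) (sharpFlat P Ω x (constSharp P (dx a))) (Y x),
    form_swap (fderiv ℝ Ω x (sharpFlat P Ω x (X x))) (Y x) (constSharp P (dx a)),
    form_swap (fderiv ℝ Ω x (Y x)) (X x) (sharpFlat P Ω x (constSharp P (dx a))),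
    form_swap (fderiv ℝ Ω x (sharpFlat P Ω x (constSharp P (dx a)))) (X x) (Y x)]

/-- For a constant bivector `π` and a closed 2-form `Ω`, the tensor field `π♯ Ω♭` is Poisson
quasi-Nijenhuis. Nondegeneracy of `π` plays no role. -/
theorem isPqN_sharpFlat {Ω : Form ι 2} (h : ContDiff ℝ ∞ Ω) (hd : ∀ x, extDeriv Ω x = 0) :
    IsPqN (fun _ => P) (sharpFlat P Ω) (torsionForm P Ω) := by
  have h1 : ContDiff ℝ 1 Ω := h.of_le (mod_cast le_top)
  have h2 : ContDiff ℝ 2 Ω := h.of_le two_le_infty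
  have hN {m : WithTop ℕ∞} (h : ContDiff ℝ m Ω) : ContDiff ℝ m (sharpFlat P Ω) :=
    contDiff_sharpFlat h
  refine ⟨isPoisson_const, hN h, ?_, compatible_sharpFlat h1 hd, fun x => ?_, fun x => ?_,
    fun X Y hX hY x => torsion_sharpFlat h1 hd (hX.of_le (mod_cast le_top))
      (hY.of_le (mod_cast le_top)) x⟩
  · exact (contDiff_extDeriv (m := ∞) (contDiff_insertN (hN h) h) (by rfl)).const_smul _
  · unfold torsionForm
    rw [extDeriv_fun_const_smul, extDeriv_extDeriv (contDiff_insertN (hN h2) h2) (by simp),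
      Pi.zero_apply, smul_zero]
  · rw [insertN_torsionForm h2 hd, extDeriv_fun_const_smul,
      extDeriv_extDeriv (contDiff_insertN (hN h2) (contDiff_insertN (hN h2) h2)) (by simp),
      Pi.zero_apply, smul_zero]

theorem IsPqN.isPN {P : Bivector ι} {N : EndoField ι} {φ : Form ι 3} (h : IsPqN P N φ)
    (hφ : ∀ x, φ x = 0) : IsPN P N := by
  refine ⟨h.poisson, h.smooth, h.compatible, fun X Y hX hY x => ?_⟩
  have : contract₂ φ X Y x = 0 := by
    ext v
    rw [contract₂_apply, hφ]
    rfl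
  rw [h.torsion_eq X Y hX hY, this, map_zero]

end Closed

/-! ### The Koszul bracket for a constant bivector -/

section Koszul

theorem closed_add {ι : Type} [Fintype ι] {k : ℕ} {α β : Form ι k} (hα : ContDiff ℝ 1 α)
    (hβ : ContDiff ℝ 1 β) (hdα : ∀ x, extDeriv α x = 0) (hdβ : ∀ x, extDeriv β x = 0)
    (x : ι → ℝ) : extDeriv (α + β) x = 0 := by
  rw [extDeriv_add (hα.differentiable one_ne_zero).differentiableAt
    (hβ.differentiable one_ne_zero).differentiableAt, hdα, hdβ, add_zero]

theorem dN_of_closed {ι : Type} [Fintype ι] {k : ℕ} {N : EndoField ι} {α : Form ι k}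
    (hd : ∀ x, extDeriv α x = 0) (x : ι → ℝ) : dN N α x = -extDeriv (insertN N α) x := by
  ext v
  rw [dN, insertN, hd]
  simp [insertEndo_apply]

theorem removeNth_zero_vecCons {V : Type*} {k : ℕ} (a : V) (w : Fin k → V) :
    (0 : Fin (k + 1)).removeNth (Matrix.vecCons a w : Fin (k + 1) → V) = w := rfl

theorem removeNth_succ_vecCons {V : Type*} {k : ℕ} (a : V) (w : Fin (k + 1) → V)
    (i : Fin (k + 1)) :
    i.succ.removeNth (Matrix.vecCons a w : Fin (k + 2) → V)
      = Matrix.vecCons a (i.removeNth w) := by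
  funext j
  refine Fin.cases ?_ (fun j => ?_) j
  · simp [Fin.removeNth]
  · simp [Fin.removeNth]

variable {ι : Type} [Fintype ι] [DecidableEq ι] {P : ((ι → ℝ) →L[ℝ] ℝ) [⋀^Fin 2]→L[ℝ] ℝ}
  {k : ℕ}

theorem contractBivector_apply (Q : Bivector ι) (η : Form ι (k + 2)) (x : ι → ℝ)
    (v : Fin k → ι → ℝ) :
    contractBivector Q η x v = (1 / 2) * ∑ a, ∑ b, Q x ![dx a, dx b] *
      η x (Matrix.vecCons (basisVec a) (Matrix.vecCons (basisVec b) v)) := by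
  simp [contractBivector, ContinuousAlternatingMap.sum_apply]

theorem contDiff_contractBivector {m : WithTop ℕ∞} {η : Form ι (k + 2)} (h : ContDiff ℝ m η) :
    ContDiff ℝ m (contractBivector (fun _ => P) η) := by
  refine contDiff_form_of_apply fun v => ?_
  simp only [contractBivector_apply]
  exact contDiff_const.mul (ContDiff.sum fun a _ => ContDiff.sum fun b _ =>
    contDiff_const.mul (contDiff_form_apply h _))

theorem fderiv_contractBivector {η : Form ι (k + 2)} (h : ContDiff ℝ 1 η) (x u : ι → ℝ)
    (v : Fin k → ι → ℝ) :
    fderiv ℝ (contractBivector (fun _ => P) η) x u v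
      = (1 / 2) * ∑ a, ∑ b, P ![dx a, dx b] *
        fderiv ℝ η x u (Matrix.vecCons (basisVec a) (Matrix.vecCons (basisVec b) v)) := by
  rw [fderiv_form_apply
    ((contDiff_contractBivector h).differentiable one_ne_zero).differentiableAt]
  simp only [contractBivector_apply]
  have h' (w : Fin (k + 2) → ι → ℝ) := ((contDiff_form_apply h w).differentiable
    one_ne_zero).differentiableAt (x := x) |>.hasFDerivAt
  rw [((HasFDerivAt.fun_sum fun a _ => HasFDerivAt.fun_sum fun b _ =>
    (h' (Matrix.vecCons (basisVec a) (Matrix.vecCons (basisVec b) v))).const_mul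
      (P ![dx a, dx b])).const_mul (1 / 2)).fderiv]
  simp [fderiv_form_apply ((h.differentiable one_ne_zero).differentiableAt (x := x))]

/-- For a constant bivector, `Δ` is a divergence: `Δ η = ∑ₐ ι_{π♯ dxₐ} ∂ₐ η`. -/
theorem brylinski_const {η : Form ι (k + 2)} (h : ContDiff ℝ 1 η) (x : ι → ℝ)
    (v : Fin (k + 1) → ι → ℝ) :
    brylinski (fun _ => P) η x v
      = ∑ a, fderiv ℝ η x (basisVec a) (Matrix.vecCons (constSharp P (dx a)) v) := by
  have hs (a : ι) : fderiv ℝ η x (basisVec a) (Matrix.vecCons (constSharp P (dx a)) v)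
      = ∑ b, P ![dx a, dx b] *
        fderiv ℝ η x (basisVec a) (Matrix.vecCons (basisVec b) v) := by
    have := form_update_eq_sum (fderiv ℝ η x (basisVec a)) (Matrix.vecCons 0 v) 0
      (constSharp P (dx a))
    have hu (w : ι → ℝ) : Function.update (Matrix.vecCons 0 v : Fin (k + 2) → ι → ℝ) 0 w
        = Matrix.vecCons w v := Fin.update_cons_zero _ _ _
    simp only [hu] at this
    rw [this]
    exact Finset.sum_congr rfl fun b _ => by rw [← apply_constSharp P (dx a) (dx b)]; rfl
  have h1 (a b : ι) :
      extDeriv η x (Matrix.vecCons (basisVec a) (Matrix.vecCons (basisVec b) v))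
        = fderiv ℝ η x (basisVec a) (Matrix.vecCons (basisVec b) v)
          - fderiv ℝ η x (basisVec b) (Matrix.vecCons (basisVec a) v)
          + ∑ i : Fin (k + 1), (-1 : ℝ) ^ (i : ℕ) * fderiv ℝ η x (v i)
            (Matrix.vecCons (basisVec a) (Matrix.vecCons (basisVec b) (i.removeNth v))) := by
    rw [extDeriv_eq_sum, Fin.sum_univ_succ, Fin.sum_univ_succ]
    simp only [removeNth_zero_vecCons, removeNth_succ_vecCons, Matrix.cons_val_zero,
      Matrix.cons_val_succ, Fin.val_succ, Fin.val_zero, pow_succ, pow_zero]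
    simp only [one_mul, mul_neg, mul_one, neg_neg, neg_mul]
    ring
  have hb : brylinski (fun _ => P) η x v = contractBivector (fun _ => P) (extDeriv η) x v
    - extDeriv (contractBivector (fun _ => P) η) x v := rfl
  rw [hb, contractBivector_apply, extDeriv_eq_sum]
  simp only [h1, hs, fderiv_contractBivector h]
  -- Only the derivatives along the contracted indices survive; the two of them agree because the
  -- coefficients of `P` are antisymmetric.
  have hswap : ∑ a, ∑ b, P ![dx a, dx b] *
        fderiv ℝ η x (basisVec b) (Matrix.vecCons (basisVec a) v)
      = -∑ a, ∑ b, P ![dx a, dx b] *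
        fderiv ℝ η x (basisVec a) (Matrix.vecCons (basisVec b) v) := by
    rw [Finset.sum_comm, ← Finset.sum_neg_distrib]
    refine Finset.sum_congr rfl fun a _ => ?_
    rw [← Finset.sum_neg_distrib]
    exact Finset.sum_congr rfl fun b _ => by rw [form_swap, neg_mul]
  have hrest (R : Fin (k + 1) → ι → ι → ℝ) :
      ∑ a, ∑ b, P ![dx a, dx b] * ∑ i : Fin (k + 1), (-1 : ℝ) ^ (i : ℕ) * R i a b
        = 2 * ∑ i : Fin (k + 1), (-1 : ℝ) ^ (i : ℕ) *
          ((1 / 2) * ∑ a, ∑ b, P ![dx a, dx b] * R i a b) := by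
    simp only [Finset.mul_sum]
    rw [Finset.sum_congr rfl fun a _ => Finset.sum_comm, Finset.sum_comm]
    refine Finset.sum_congr rfl fun i _ => Finset.sum_congr rfl fun a _ =>
      Finset.sum_congr rfl fun b _ => ?_
    ring
  simp only [mul_add, mul_sub, Finset.sum_add_distrib, Finset.sum_sub_distrib]
  rw [hswap, hrest fun i a b => fderiv ℝ η x (v i)
    (Matrix.vecCons (basisVec a) (Matrix.vecCons (basisVec b) (i.removeNth v)))]
  ring

theorem koszul_self_apply {Ω : Form ι 2} (h : ContDiff ℝ 1 Ω) (x u v w : ι → ℝ) :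
    koszul (fun _ => P) Ω Ω x ![u, v, w]
      = 2 * (fderiv ℝ Ω x (sharpFlat P Ω x u) ![v, w] + fderiv ℝ Ω x (sharpFlat P Ω x v) ![w, u]
          + fderiv ℝ Ω x (sharpFlat P Ω x w) ![u, v]) := by
  have hs (u v w : ι → ℝ) : fderiv ℝ Ω x (sharpFlat P Ω x u) ![v, w]
      = ∑ a, Ω x ![constSharp P (dx a), u] * fderiv ℝ Ω x (basisVec a) ![v, w] := by
    rw [apply_eq_sum (fderiv ℝ Ω x), ContinuousAlternatingMap.sum_apply, sharpFlat_eq_sum]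
    rfl
  change brylinski (fun _ => P) (k := 2) (fun y => wedge (Ω y) (Ω y)) x ![u, v, w]
    - wedge (k := 1) (l := 2) (brylinski (fun _ => P) (k := 0) Ω x) (Ω x) ![u, v, w]
    - wedge (k := 2) (l := 1) (Ω x) (brylinski (fun _ => P) (k := 0) Ω x) ![u, v, w] = _
  rw [wedge_one_two, wedge_two_one, brylinski_const (contDiff_wedge h h), hs, hs, hs]
  simp only [brylinski_const h, fderiv_wedge h h, ContinuousAlternatingMap.add_apply]
  rw [Finset.sum_congr rfl fun a _ => by rw [wedge_two_two, wedge_two_two]]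
  simp only [Finset.mul_sum, Finset.sum_mul, ← Finset.sum_add_distrib, ← Finset.sum_sub_distrib]
  refine Finset.sum_congr rfl fun a _ => ?_
  ring

/-- `d_N Ω + ½ [Ω, Ω]_π` measures how the torsion changes when `N` is deformed by `π♯ Ω♭`. -/
theorem deformForm_sharpFlat {Ω₁ Ω₂ : Form ι 2} (h₁ : ContDiff ℝ 1 Ω₁)
    (h₂ : ContDiff ℝ 1 Ω₂) (hd₁ : ∀ x, extDeriv Ω₁ x = 0) (hd₂ : ∀ x, extDeriv Ω₂ x = 0)
    (x : ι → ℝ) :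
    deformForm (fun _ => P) (sharpFlat P Ω₁) Ω₂ x
      = torsionForm P (Ω₁ + Ω₂) x - torsionForm P Ω₁ x := by
  refine form_three_ext fun u v w => ?_
  have h1 := (h₁.differentiable one_ne_zero).differentiableAt (x := x)
  have h2 := (h₂.differentiable one_ne_zero).differentiableAt (x := x)
  have h₁₂ : ContDiff ℝ 1 (Ω₁ + Ω₂) := h₁.add h₂
  have hN (v : ι → ℝ) : sharpFlat P (Ω₁ + Ω₂) x v = sharpFlat P Ω₁ x v + sharpFlat P Ω₂ x v := by
    simp only [sharpFlat_eq_sum]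
    rfl
  rw [ContinuousAlternatingMap.sub_apply, torsionForm_apply h₁₂ (closed_add h₁ h₂ hd₁ hd₂),
    torsionForm_apply h₁ hd₁, deformForm, ContinuousAlternatingMap.add_apply,
    ContinuousAlternatingMap.smul_apply, koszul_self_apply h₂, dN_of_closed hd₂,
    ContinuousAlternatingMap.neg_apply, extDeriv_insertN_sharpFlat h₁ h₂ hd₁ hd₂, hN, hN, hN,
    fderiv_add h1 h2]
  simp only [_root_.add_apply, map_add, ContinuousAlternatingMap.add_apply, smul_eq_mul]
  ring

omit [DecidableEq ι] in
theorem deform_sharpFlat (Ω₁ Ω₂ : Form ι 2) :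
    deform (fun _ => P) (sharpFlat P Ω₁) Ω₂ = sharpFlat P (Ω₁ + Ω₂) := by
  classical
  funext x
  ext v : 1
  have h : deform (fun _ => P) (sharpFlat P Ω₁) Ω₂ x v
    = sharpFlat P Ω₁ x v + sharpFlat P Ω₂ x v := rfl
  rw [h]
  simp only [sharpFlat_eq_sum]
  rfl

end Koszul

/-! ### The canonical structure and the potentials -/

section Canonical

variable {n : ℕ}

theorem wedge₂_apply {ι : Type} [Fintype ι] (a b : ι) (u v : ι → ℝ) :
    wedge₂ a b ![u, v] = u a * v b - v a * u b := by
  rw [wedge₂, wedge_one_one]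
  rfl

theorem wedge₃_apply {ι : Type} [Fintype ι] (a b c : ι) (u v w : ι → ℝ) :
    wedge₃ a b c ![u, v, w] = (u a * v b - v a * u b) * w c + (v a * w b - w a * v b) * u c
      + (w a * u b - u a * w b) * v c := by
  rw [wedge₃, wedge_two_one, wedge₂_apply, wedge₂_apply, wedge₂_apply]
  rfl

theorem canonicalP_apply (α β : Phase n →L[ℝ] ℝ) :
    canonicalP n 0 ![α, β]
      = ∑ i, (α (basisVec (pIdx i)) * β (basisVec (qIdx i))
        - β (basisVec (pIdx i)) * α (basisVec (qIdx i))) := by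
  simp [canonicalP, biwedge, wedge_one_one, ContinuousAlternatingMap.sum_apply]

theorem constSharp_canonical_q (α : Phase n →L[ℝ] ℝ) (i : Fin n) :
    constSharp (canonicalP n 0) α (qIdx i) = α (basisVec (pIdx i)) := by
  have h := apply_constSharp (canonicalP n 0) α (dx (qIdx i))
  rw [canonicalP_apply] at h
  refine h.trans ?_
  simp [dx, basisVec, Pi.single_apply]

theorem constSharp_canonical_p (α : Phase n →L[ℝ] ℝ) (i : Fin n) :
    constSharp (canonicalP n 0) α (pIdx i) = -α (basisVec (qIdx i)) := by
  have h := apply_constSharp (canonicalP n 0) α (dx (pIdx i))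
  rw [canonicalP_apply] at h
  refine h.trans ?_
  simp [dx, basisVec, Pi.single_apply]

theorem sharpFlat_canonical_q (Ω : Form (Idx n) 2) (x v : Phase n) (i : Fin n) :
    sharpFlat (canonicalP n 0) Ω x v (qIdx i) = Ω x ![v, basisVec (pIdx i)] := by
  rw [← flat_apply, ← constSharp_canonical_q]
  rfl

theorem sharpFlat_canonical_p (Ω : Form (Idx n) 2) (x v : Phase n) (i : Fin n) :
    sharpFlat (canonicalP n 0) Ω x v (pIdx i) = -Ω x ![v, basisVec (qIdx i)] := by
  rw [← flat_apply, ← constSharp_canonical_p]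
  rfl

theorem phase_ext {u v : Phase n} (hq : ∀ i, u (qIdx i) = v (qIdx i))
    (hp : ∀ i, u (pIdx i) = v (pIdx i)) : u = v := by
  funext a
  rcases a with i | i
  · exact hq i
  · exact hp i

/-- The closed 2-form `Ω₀ = ∑ p_i dq_i ∧ dp_i`, for which `π♯ Ω₀♭` is `canonicalN`. -/
noncomputable def canonicalOmega (n : ℕ) : Form (Idx n) 2 := fun x =>
  ∑ i, x (pIdx i) • wedge₂ (qIdx i) (pIdx i)

theorem canonicalOmega_apply (x u v : Phase n) : canonicalOmega n x ![u, v]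
    = ∑ i, x (pIdx i) * (u (qIdx i) * v (pIdx i) - v (qIdx i) * u (pIdx i)) := by
  simp [canonicalOmega, ContinuousAlternatingMap.sum_apply, wedge₂_apply]

theorem canonicalN_apply_q (x v : Phase n) (i : Fin n) :
    canonicalN n x v (qIdx i) = x (pIdx i) * v (qIdx i) := by
  simp [canonicalN, tens, dx, basisVec, Pi.single_apply]

theorem canonicalN_apply_p (x v : Phase n) (i : Fin n) :
    canonicalN n x v (pIdx i) = x (pIdx i) * v (pIdx i) := by
  simp [canonicalN, tens, dx, basisVec, Pi.single_apply]

theorem canonicalN_eq : canonicalN n = sharpFlat (canonicalP n 0) (canonicalOmega n) := by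
  funext x
  ext v : 1
  refine phase_ext (fun i => ?_) fun i => ?_
  · rw [sharpFlat_canonical_q, canonicalN_apply_q, canonicalOmega_apply]
    simp [basisVec, Pi.single_apply]
  · rw [sharpFlat_canonical_p, canonicalN_apply_p, canonicalOmega_apply]
    simp [basisVec, Pi.single_apply]

theorem contDiff_coord {ι : Type} [Fintype ι] {m : WithTop ℕ∞} (a : ι) :
    ContDiff ℝ m fun x : ι → ℝ => x a := contDiff_apply ℝ ℝ a

theorem contDiff_canonicalOmega {m : WithTop ℕ∞} : ContDiff ℝ m (canonicalOmega n) :=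
  ContDiff.sum fun _ _ => (contDiff_coord _).smul contDiff_const

theorem fderiv_canonicalOmega (x w : Phase n) :
    fderiv ℝ (canonicalOmega n) x w = canonicalOmega n w := by
  have h (i : Fin n) := ((dx (ι := Idx n) (pIdx i)).hasFDerivAt (x := x)).smul_const
    (wedge₂ (qIdx i) (pIdx i))
  have h' := HasFDerivAt.fun_sum (u := Finset.univ) fun i _ => h i
  have h'' : fderiv ℝ (canonicalOmega n) x = _ := h'.fderiv
  rw [h'']
  simp [canonicalOmega, dx]

theorem extDeriv_canonicalOmega (x : Phase n) : extDeriv (canonicalOmega n) x = 0 := by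
  refine form_three_ext fun u v w => ?_
  rw [extDeriv_two_form]
  simp only [fderiv_canonicalOmega, canonicalOmega_apply, ← Finset.sum_add_distrib]
  exact Finset.sum_eq_zero fun i _ => by ring

theorem torsionForm_canonicalOmega (x : Phase n) :
    torsionForm (canonicalP n 0) (canonicalOmega n) x = 0 := by
  refine form_three_ext fun u v w => ?_
  rw [torsionForm_apply contDiff_canonicalOmega extDeriv_canonicalOmega, ← canonicalN_eq]
  simp only [fderiv_canonicalOmega, canonicalOmega_apply, canonicalN_apply_p,
    ← Finset.sum_add_distrib]
  exact Finset.sum_eq_zero fun i _ => by ring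

theorem isPN_canonical (n : ℕ) : IsPN (canonicalP n) (canonicalN n) := by
  rw [canonicalN_eq]
  exact (isPqN_sharpFlat contDiff_canonicalOmega extDeriv_canonicalOmega).isPN
    torsionForm_canonicalOmega

end Canonical

section Potential

variable {n : ℕ} {V W : Fin n → Fin n → ℝ → ℝ}

theorem hasFDerivAt_pot {ι : Type} [Fintype ι] {f : ℝ → ℝ} {f' : ℝ} {a b : ι} {x : ι → ℝ}
    (h : HasDerivAt f f' (x a - x b)) :
    HasFDerivAt (fun y : ι → ℝ => f (y a - y b)) (f' • (dx a - dx b)) x :=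
  h.comp_hasFDerivAt x ((dx a).hasFDerivAt.sub (dx b).hasFDerivAt)

theorem contDiff_pot {ι : Type} [Fintype ι] {m : WithTop ℕ∞} {f : ℝ → ℝ} (h : ContDiff ℝ m f)
    (a b : ι) : ContDiff ℝ m fun y : ι → ℝ => f (y a - y b) :=
  h.comp ((contDiff_coord a).sub (contDiff_coord b))

theorem potOmega_apply (x u v : Phase n) : potOmega V x ![u, v] = ∑ i, ∑ j ∈ Finset.Ioi i,
    (V i j (x (qIdx i) - x (qIdx j)) * (u (qIdx j) * v (qIdx i) - v (qIdx j) * u (qIdx i))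
      + (u (pIdx j) * v (pIdx i) - v (pIdx j) * u (pIdx i))) := by
  simp [potOmega, ContinuousAlternatingMap.sum_apply, wedge₂_apply]

theorem contDiff_potOmega {m : WithTop ℕ∞} (h : ∀ i j, i < j → ContDiff ℝ m (V i j)) :
    ContDiff ℝ m (potOmega V) :=
  ContDiff.sum fun i _ => ContDiff.sum fun j hj =>
    ((contDiff_pot (h i j (Finset.mem_Ioi.1 hj)) _ _).smul contDiff_const).add contDiff_const

theorem fderiv_potOmega (h : ∀ i j, i < j → ContDiff ℝ ∞ (V i j)) (x z u v : Phase n) :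
    fderiv ℝ (potOmega V) x z ![u, v] = ∑ i, ∑ j ∈ Finset.Ioi i,
      deriv (V i j) (x (qIdx i) - x (qIdx j)) * (z (qIdx i) - z (qIdx j))
        * (u (qIdx j) * v (qIdx i) - v (qIdx j) * u (qIdx i)) := by
  have h1 (i : Fin n) := HasFDerivAt.fun_sum (u := Finset.Ioi i) fun j hj =>
    ((hasFDerivAt_pot (x := x) (a := qIdx i) (b := qIdx j)
      ((h i j (Finset.mem_Ioi.1 hj)).differentiable
        (by simp)).differentiableAt.hasDerivAt).smul_const (wedge₂ (qIdx j) (qIdx i))).add_const (wedge₂ (pIdx j) (pIdx i))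
  have h2 := HasFDerivAt.fun_sum (u := Finset.univ) fun i _ => h1 i
  have h3 : fderiv ℝ (potOmega V) x = _ := h2.fderiv
  rw [h3]
  simp [ContinuousAlternatingMap.sum_apply, wedge₂_apply, dx]

theorem extDeriv_potOmega (h : ∀ i j, i < j → ContDiff ℝ ∞ (V i j)) (x : Phase n) :
    extDeriv (potOmega V) x = 0 := by
  refine form_three_ext fun u v w => ?_
  rw [extDeriv_two_form]
  simp only [fderiv_potOmega h, ← Finset.sum_add_distrib]
  exact Finset.sum_eq_zero fun i _ => Finset.sum_eq_zero fun j _ => by ring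

theorem extDeriv_potTheta (h : ∀ i j, i < j → ∀ t, HasDerivAt (W i j) (V i j t) t)
    (x : Phase n) : extDeriv (potTheta W) x = potOmega V x := by
  have h1 (i : Fin n) := HasFDerivAt.fun_sum (u := Finset.Ioi i) fun j hj =>
    ((hasFDerivAt_pot (x := x) (a := qIdx i) (b := qIdx j)
      (h i j (Finset.mem_Ioi.1 hj) _)).neg.smul_const (covec (dx (qIdx i)))).add
      (((dx (ι := Idx n) (pIdx j)).hasFDerivAt (x := x)).smul_const (covec (dx (pIdx i))))
  have h2 := HasFDerivAt.fun_sum (u := Finset.univ) fun i _ => h1 i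
  have h3 : fderiv ℝ (potTheta W) x = _ := h2.fderiv
  refine form_two_ext fun u v => ?_
  rw [extDeriv_one_form, h3, potOmega_apply]
  simp only [_root_.sum_apply, ContinuousAlternatingMap.sum_apply, ← Finset.sum_sub_distrib]
  refine Finset.sum_congr rfl fun i _ => Finset.sum_congr rfl fun j _ => ?_
  simp [dx]
  ring

theorem deform_potOmega : deform (canonicalP n) (canonicalN n) (potOmega V) = potN V := by
  funext x
  ext v : 1
  have h : deform (canonicalP n) (canonicalN n) (potOmega V) x v
    = canonicalN n x v + sharpFlat (canonicalP n 0) (potOmega V) x v := rfl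
  have h' : potN V x = canonicalN n x + ((∑ i : Fin n, ∑ j ∈ Finset.Ioi i,
      (tens (qIdx i) (pIdx j) - tens (qIdx j) (pIdx i))) + ∑ i : Fin n, ∑ j ∈ Finset.Ioi i,
        V i j (x (qIdx i) - x (qIdx j)) • (tens (pIdx j) (qIdx i) - tens (pIdx i) (qIdx j))) :=
    add_assoc _ _ _
  rw [h, h', _root_.add_apply]
  congr 1
  refine phase_ext (fun i => ?_) fun i => ?_
  · rw [sharpFlat_canonical_q, potOmega_apply]
    simp [basisVec, tens, dx, -Finset.sum_sub_distrib]
    refine Finset.sum_congr rfl fun k _ => Finset.sum_congr rfl fun l _ => ?_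
    simp only [Pi.single_apply, Sum.inl.injEq, Sum.inr.injEq, eq_comm (a := i)]
    ring
  · rw [sharpFlat_canonical_p, potOmega_apply]
    simp [basisVec, tens, dx, -Finset.sum_sub_distrib, ← Finset.sum_neg_distrib]
    refine Finset.sum_congr rfl fun k _ => Finset.sum_congr rfl fun l _ => ?_
    simp only [Pi.single_apply, Sum.inl.injEq, Sum.inr.injEq, eq_comm (a := i)]
    ring

/-- The form `Ω₀ = ∑ p_i dq_i ∧ dp_i` is linear in the base point, so the left side is the
derivative of `Ω₀` along `π♯ Ω♭ u`; moving `π♯` across turns it into a single value of `Ω`. -/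
theorem canonicalOmega_sharpFlat (Ω : Form (Idx n) 2) (x u v w : Phase n) :
    canonicalOmega n (sharpFlat (canonicalP n 0) Ω x u) ![v, w]
      = Ω x ![Sum.elim (fun i => v (qIdx i) * w (pIdx i) - w (qIdx i) * v (pIdx i)) 0, u] := by
  have hu (z : Phase n) : Function.update ![0, u] 0 z = ![z, u] := by
    funext i; fin_cases i <;> rfl
  have h (z : Phase n) := form_update_eq_sum (Ω x) ![0, u] 0 z
  simp only [hu] at h
  rw [canonicalOmega_apply, h, Fintype.sum_sum_type]
  simp only [sharpFlat_canonical_p, Sum.elim_inl, Sum.elim_inr, Pi.zero_apply, zero_mul,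
    Finset.sum_const_zero, add_zero]
  exact Finset.sum_congr rfl fun i _ => by rw [form_swap]; ring

theorem dN_potOmega (h : ∀ i j, i < j → ContDiff ℝ ∞ (V i j)) :
    dN (canonicalN n) (potOmega V) = potDN V := by
  funext x
  refine form_three_ext fun u v w => ?_
  rw [dN_of_closed (extDeriv_potOmega h), canonicalN_eq, ContinuousAlternatingMap.neg_apply,
    extDeriv_insertN_sharpFlat contDiff_canonicalOmega
      (contDiff_potOmega fun i j hij => (h i j hij).of_le (mod_cast le_top))
      extDeriv_canonicalOmega (extDeriv_potOmega h), ← canonicalN_eq]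
  simp only [fderiv_canonicalOmega, canonicalOmega_sharpFlat]
  simp only [fderiv_potOmega h, potOmega_apply, canonicalN_apply_q, ← Finset.sum_add_distrib,
    ← Finset.sum_sub_distrib, ← Finset.sum_neg_distrib, potDN, ContinuousAlternatingMap.sum_apply,
    ContinuousAlternatingMap.smul_apply, ContinuousAlternatingMap.add_apply, wedge₃_apply,
    Sum.elim_inl, Sum.elim_inr, Pi.zero_apply, smul_eq_mul]
  exact Finset.sum_congr rfl fun i _ => Finset.sum_congr rfl fun j _ => by ring

theorem sharpFlat_potOmega_q (x u : Phase n) (i : Fin n) :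
    sharpFlat (canonicalP n 0) (potOmega V) x u (qIdx i)
      = ∑ k, ∑ l ∈ Finset.Ioi k, (kron i k * u (pIdx l) - kron i l * u (pIdx k)) := by
  rw [sharpFlat_canonical_q, potOmega_apply]
  refine Finset.sum_congr rfl fun k _ => Finset.sum_congr rfl fun l _ => ?_
  simp [basisVec, Pi.single_apply, kron, eq_comm (a := i)]

theorem koszul_potOmega (h : ∀ i j, i < j → ContDiff ℝ ∞ (V i j)) :
    koszul (canonicalP n) (potOmega V) (potOmega V) = potKoszul V := by
  funext x
  refine form_three_ext fun u v w => ?_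
  change koszul (fun _ => canonicalP n 0) (potOmega V) (potOmega V) x ![u, v, w] = _
  rw [koszul_self_apply (contDiff_potOmega fun i j hij => (h i j hij).of_le (mod_cast le_top))]
  simp only [fderiv_potOmega h, ← Finset.sum_add_distrib, potKoszul,
    ContinuousAlternatingMap.sum_apply, ContinuousAlternatingMap.smul_apply,
    ContinuousAlternatingMap.add_apply, wedge₃_apply, smul_eq_mul]
  congr 1
  refine Finset.sum_congr rfl fun i _ => Finset.sum_congr rfl fun j _ => ?_
  simp only [sharpFlat_potOmega_q, ← Finset.sum_sub_distrib, mul_assoc, ← mul_add]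
  simp only [Finset.sum_mul, ← Finset.sum_add_distrib]
  congr 1
  refine Finset.sum_congr rfl fun k _ => Finset.sum_congr rfl fun l _ => ?_
  ring

theorem isPqN_potOmega (h : ∀ i j, i < j → ContDiff ℝ ∞ (V i j)) :
    IsPqN (canonicalP n) (deform (canonicalP n) (canonicalN n) (potOmega V))
      (deformForm (canonicalP n) (canonicalN n) (potOmega V)) := by
  have h1 : ContDiff ℝ 1 (potOmega V) :=
    contDiff_potOmega fun i j hij => (h i j hij).of_le (mod_cast le_top)
  have hΩ : ContDiff ℝ ∞ (canonicalOmega n + potOmega V) :=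
    contDiff_canonicalOmega.add (contDiff_potOmega h)
  have hd := closed_add contDiff_canonicalOmega h1 extDeriv_canonicalOmega (extDeriv_potOmega h)
  have hN : deform (canonicalP n) (canonicalN n) (potOmega V)
      = sharpFlat (canonicalP n 0) (canonicalOmega n + potOmega V) := by
    rw [canonicalN_eq]
    exact deform_sharpFlat _ _
  have hφ : deformForm (canonicalP n) (canonicalN n) (potOmega V)
      = torsionForm (canonicalP n 0) (canonicalOmega n + potOmega V) := by
    funext x
    rw [canonicalN_eq]
    refine (deformForm_sharpFlat (P := canonicalP n 0) contDiff_canonicalOmega h1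
      extDeriv_canonicalOmega (extDeriv_potOmega h) x).trans ?_
    rw [torsionForm_canonicalOmega, sub_zero]
  rw [hN, hφ]
  exact isPqN_sharpFlat hΩ hd

end Potential

/-! ### The Toda potentials -/

section Toda

variable {m : ℕ}

/-- A sum over pairs of particles that is supported on consecutive particles and on the pair
(first, last). For two particles these are the same pair, and both terms contribute. -/
theorem sum_pairs_toda {M : Type*} [AddCommMonoid M] (A : Fin (m + 2) → Fin (m + 2) → M) (B : M) :
    ∑ i : Fin (m + 2), ∑ j ∈ Finset.Ioi i, ((if i.val + 1 = j.val then A i j else 0)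
        + (if i = 0 ∧ j = Fin.last (m + 1) then B else 0))
      = ∑ i : Fin (m + 1), A i.castSucc i.succ + B := by
  simp only [Finset.sum_add_distrib]
  congr 1
  · rw [Fin.sum_univ_castSucc]
    have h0 : ∑ j ∈ Finset.Ioi (Fin.last (m + 1)),
        (if (Fin.last (m + 1)).val + 1 = j.val then A (Fin.last (m + 1)) j else 0) = 0 :=
      Finset.sum_eq_zero fun j _ => if_neg (by have := j.isLt; simp; omega)
    rw [h0, add_zero]
    refine Finset.sum_congr rfl fun i _ => ?_
    rw [Finset.sum_eq_single i.succ]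
    · simp
    · intro j _ hj
      refine if_neg fun h => hj (Fin.ext ?_)
      simpa using h.symm
    · intro h
      exact absurd (Finset.mem_Ioi.2 Fin.castSucc_lt_succ) h
  · rw [Finset.sum_eq_single 0, Finset.sum_eq_single (Fin.last (m + 1))]
    · simp
    · intro j _ hj
      exact if_neg fun h => hj h.2
    · intro h
      exact absurd (Finset.mem_Ioi.2 (Fin.last_pos)) h
    · intro i _ hi
      exact Finset.sum_eq_zero fun j _ => if_neg fun h => hi h.1
    · simp

variable (f : Fin (m + 2) → ℝ)

theorem sum_todaV_smul {M : Type*} [AddCommGroup M] [Module ℝ M] (x : Phase (m + 2))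
    (T : Fin (m + 2) → Fin (m + 2) → M) :
    ∑ i : Fin (m + 2), ∑ j ∈ Finset.Ioi i, todaV f i j (x (qIdx i) - x (qIdx j)) • T i j
      = ∑ i : Fin (m + 1), (f i.castSucc * Real.exp (x (qIdx i.castSucc) - x (qIdx i.succ))) •
          T i.castSucc i.succ
        + (f (Fin.last (m + 1)) * Real.exp (x (qIdx (Fin.last (m + 1))) - x (qIdx 0))) •
          T 0 (Fin.last (m + 1)) := by
  rw [← sum_pairs_toda (fun i j => (f i * Real.exp (x (qIdx i) - x (qIdx j))) • T i j)]
  refine Finset.sum_congr rfl fun i _ => Finset.sum_congr rfl fun j _ => ?_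
  rw [todaV, add_smul, ite_smul, zero_smul]
  congr 1
  split_ifs with h
  · rw [h.1, h.2, neg_sub]
  · rw [zero_smul]

theorem deriv_todaV (i j : Fin (m + 2)) (t : ℝ) :
    deriv (todaV f i j) t = (if i.val + 1 = j.val then f i * Real.exp t else 0)
      + (if i = 0 ∧ j = Fin.last (m + 1) then -(f (Fin.last (m + 1)) * Real.exp (-t)) else 0) := by
  have h1 : HasDerivAt (fun t => if i.val + 1 = j.val then f i * Real.exp t else 0)
      (if i.val + 1 = j.val then f i * Real.exp t else 0) t := by
    split_ifs
    · exact (Real.hasDerivAt_exp t).const_mul _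
    · exact hasDerivAt_const _ _
  have h2 : HasDerivAt (fun t => if i = 0 ∧ j = Fin.last (m + 1) then
      f (Fin.last (m + 1)) * Real.exp (-t) else 0)
      (if i = 0 ∧ j = Fin.last (m + 1) then -(f (Fin.last (m + 1)) * Real.exp (-t)) else 0) t := by
    split_ifs
    · simpa using ((hasDerivAt_neg t).exp).const_mul (f (Fin.last (m + 1)))
    · exact hasDerivAt_const _ _
  exact (h1.add h2).deriv

theorem contDiff_todaV (i j : Fin (m + 2)) : ContDiff ℝ ∞ (todaV f i j) := by
  unfold todaV
  refine ContDiff.add ?_ ?_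
  · split_ifs
    · exact contDiff_const.mul Real.contDiff_exp
    · exact contDiff_const
  · split_ifs
    · exact contDiff_const.mul (Real.contDiff_exp.comp contDiff_neg)
    · exact contDiff_const

theorem sum_deriv_todaV_smul {M : Type*} [AddCommGroup M] [Module ℝ M] (x : Phase (m + 2))
    (T : Fin (m + 2) → Fin (m + 2) → M) :
    ∑ i : Fin (m + 2), ∑ j ∈ Finset.Ioi i, deriv (todaV f i j) (x (qIdx i) - x (qIdx j)) • T i j
      = ∑ i : Fin (m + 1), (f i.castSucc * Real.exp (x (qIdx i.castSucc) - x (qIdx i.succ))) •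
          T i.castSucc i.succ
        - (f (Fin.last (m + 1)) * Real.exp (x (qIdx (Fin.last (m + 1))) - x (qIdx 0))) •
          T 0 (Fin.last (m + 1)) := by
  rw [sub_eq_add_neg, ← neg_smul,
    ← sum_pairs_toda (fun i j => (f i * Real.exp (x (qIdx i) - x (qIdx j))) • T i j)]
  refine Finset.sum_congr rfl fun i _ => Finset.sum_congr rfl fun j _ => ?_
  rw [deriv_todaV, add_smul, ite_smul, zero_smul]
  congr 1
  split_ifs with h
  · rw [h.1, h.2, neg_sub]
  · rw [zero_smul]

theorem potN_todaV : potN (todaV f) = todaN f := by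
  funext x
  rw [potN, sum_todaV_smul f x fun i j => tens (pIdx j) (qIdx i) - tens (pIdx i) (qIdx j), todaN,
    dasOkuboN, ← add_assoc, ← neg_sub (tens (pIdx 0) _), smul_neg, ← sub_eq_add_neg]

/-- The coefficients of `∑_{k<l} ((δ_il - δ_jl) a_k + (δ_jk - δ_ik) a_l)` as a combination of the
`a_k`. -/
theorem sum_kron_smul {n : ℕ} {M : Type*} [AddCommGroup M] [Module ℝ M] (i j : Fin n)
    (a : Fin n → M) :
    ∑ k, ∑ l ∈ Finset.Ioi k, ((kron i l - kron j l) • a k + (kron j k - kron i k) • a l)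
      = ∑ k, (((if k < i then (1 : ℝ) else 0) - (if k < j then 1 else 0))
        + ((if j < k then 1 else 0) - (if i < k then 1 else 0))) • a k := by
  have h1 (i k : Fin n) : ∑ l ∈ Finset.Ioi k, kron i l = if k < i then (1 : ℝ) else 0 := by
    simp [kron]
  have h2 (j : Fin n) : ∑ k, ∑ l ∈ Finset.Ioi k, kron j k • a l
      = ∑ l, (if j < l then (1 : ℝ) else 0) • a l := by
    rw [Finset.sum_eq_single j]
    · simp only [kron, if_true, one_smul, ite_smul, zero_smul, ← Finset.sum_filter]
      exact Finset.sum_congr (by ext; simp) fun _ _ => rfl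
    · intro k _ hk
      simp [kron, hk.symm]
    · simp
  simp only [add_smul, sub_smul, Finset.sum_add_distrib, Finset.sum_sub_distrib, h2,
    ← Finset.sum_smul, h1]

/-- For consecutive particles the combination of `sum_kron_smul` is `-(a_i + a_{i+1})`, which is
why the contributions of `V' = V` to `d_N Ω` and `½ [Ω, Ω]_π` cancel. -/
theorem sum_kron_adjacent {M : Type*} [AddCommGroup M] [Module ℝ M] (i : Fin (m + 1))
    (a : Fin (m + 2) → M) :
    ∑ k, (((if k < i.castSucc then (1 : ℝ) else 0) - (if k < i.succ then 1 else 0))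
      + ((if i.succ < k then 1 else 0) - (if i.castSucc < k then 1 else 0))) • a k
      = -(a i.castSucc + a i.succ) := by
  have hc (k : Fin (m + 2)) : (((if k < i.castSucc then (1 : ℝ) else 0)
      - (if k < i.succ then 1 else 0))
      + ((if i.succ < k then 1 else 0) - (if i.castSucc < k then 1 else 0)))
      = -((if k = i.castSucc then 1 else 0) + (if k = i.succ then 1 else 0)) := by
    simp only [Fin.lt_def, Fin.ext_iff, Fin.val_castSucc, Fin.val_succ]
    split_ifs <;> first | (exfalso; omega) | norm_num
  simp [hc, add_smul, Finset.sum_add_distrib, add_comm]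

/-- For the pair (first, last) all the intermediate particles contribute twice. -/
theorem sum_kron_ends {M : Type*} [AddCommGroup M] [Module ℝ M] (a : Fin (m + 2) → M) :
    ∑ k, (((if k < 0 then (1 : ℝ) else 0) - (if k < Fin.last (m + 1) then 1 else 0))
      + ((if Fin.last (m + 1) < k then 1 else 0) - (if 0 < k then 1 else 0))) • a k
      = a 0 + a (Fin.last (m + 1)) - (2 : ℝ) • ∑ k, a k := by
  have hc (k : Fin (m + 2)) : (((if k < 0 then (1 : ℝ) else 0)
      - (if k < Fin.last (m + 1) then 1 else 0))
      + ((if Fin.last (m + 1) < k then 1 else 0) - (if 0 < k then 1 else 0)))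
      = (if k = 0 then 1 else 0) + (if k = Fin.last (m + 1) then 1 else 0) - 2 := by
    have := k.isLt
    simp only [Fin.lt_def, Fin.ext_iff, Fin.val_last, Fin.val_zero]
    split_ifs <;> first | (exfalso; omega) | norm_num
  simp only [hc, add_smul, sub_smul, Finset.sum_add_distrib, Finset.sum_sub_distrib, ite_smul,
    one_smul, zero_smul, Finset.sum_ite_eq', Finset.mem_univ, if_true, Finset.smul_sum]

theorem deformForm_todaV :
    deformForm (canonicalP (m + 2)) (canonicalN (m + 2)) (potOmega (todaV f)) = todaForm f := by
  have h : ∀ i j : Fin (m + 2), i < j → ContDiff ℝ ∞ (todaV f i j) :=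
    fun i j _ => contDiff_todaV f i j
  funext x
  unfold deformForm
  rw [dN_potOmega h, koszul_potOmega h, potDN, potKoszul, smul_smul,
    sum_todaV_smul f x fun i j => wedge₃ (qIdx i) (qIdx j) (pIdx i)
      + wedge₃ (qIdx i) (qIdx j) (pIdx j)]
  have hk (i j : Fin (m + 2)) :=
    sum_kron_smul i j fun k => (wedge₃ (qIdx i) (qIdx j) (pIdx k) : _ [⋀^Fin 3]→L[ℝ] ℝ)
  simp only [hk]
  rw [sum_deriv_todaV_smul f x fun i j => ∑ k, (((if k < i then (1 : ℝ) else 0)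
    - (if k < j then 1 else 0)) + ((if j < k then 1 else 0) - (if i < k then 1 else 0)))
      • wedge₃ (qIdx i) (qIdx j) (pIdx k)]
  have hadj (i : Fin (m + 1)) := sum_kron_adjacent i fun k =>
    (wedge₃ (qIdx i.castSucc) (qIdx i.succ) (pIdx k) : _ [⋀^Fin 3]→L[ℝ] ℝ)
  have hends := sum_kron_ends fun k : Fin (m + 2) =>
    (wedge₃ (qIdx 0) (qIdx (Fin.last (m + 1))) (pIdx k) : _ [⋀^Fin 3]→L[ℝ] ℝ)
  simp only [hadj, hends, todaForm]
  simp only [smul_neg, Finset.sum_neg_distrib]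
  module

theorem isPqN_toda : IsPqN (canonicalP (m + 2)) (todaN f) (todaForm f) := by
  have := isPqN_potOmega (n := m + 2) (V := todaV f) fun i j _ => contDiff_todaV f i j
  rwa [deform_potOmega, potN_todaV, deformForm_todaV] at this

end Toda

/-! ### Traces of the deformed tensor field and of its square -/

section Trace

variable {n : ℕ} {V : Fin n → Fin n → ℝ → ℝ}

theorem trace_comp_tens {ι : Type} [Fintype ι] [DecidableEq ι] (A : (ι → ℝ) →ₗ[ℝ] (ι → ℝ))
    (a b : ι) : LinearMap.trace ℝ (ι → ℝ) (A * (tens a b : (ι → ℝ) →ₗ[ℝ] (ι → ℝ)))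
      = A (basisVec a) b := by
  have : A * (tens a b : (ι → ℝ) →ₗ[ℝ] (ι → ℝ))
      = (dx b : (ι → ℝ) →ₗ[ℝ] ℝ).smulRight (A (basisVec a)) := by
    ext v c
    simp [tens, dx]
  rw [this, LinearMap.trace_smulRight]
  rfl

/-- A sum over pairs `k < l` against the antisymmetrised delta of a pair `i < j`. -/
theorem sum_pairs_delta (G : Fin n → Fin n → ℝ) {i j : Fin n} (hij : i < j) :
    ∑ k, ∑ l ∈ Finset.Ioi k, G k l * ((if k = i then 1 else 0) * (if l = j then 1 else 0)
      - (if l = i then 1 else 0) * (if k = j then 1 else 0)) = G i j := by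
  rw [Finset.sum_eq_single i, Finset.sum_eq_single j]
  · simp [hij.ne]
  · intro l _ hl
    simp [hl, hij.ne]
  · intro h
    exact absurd (Finset.mem_Ioi.2 hij) h
  · intro k _ hk
    refine Finset.sum_eq_zero fun l hl => ?_
    rcases eq_or_ne k j with rfl | hkj
    · have : l ≠ i := fun h => lt_asymm hij (h ▸ Finset.mem_Ioi.1 hl)
      simp [hk, this]
    · simp [hk, hkj]
  · simp

theorem potN_apply_q (x v : Phase n) (i : Fin n) : potN V x v (qIdx i)
    = x (pIdx i) * v (qIdx i) + potOmega V x ![v, basisVec (pIdx i)] := by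
  rw [← deform_potOmega, ← canonicalN_apply_q, ← sharpFlat_canonical_q]
  rfl

theorem potN_apply_p (x v : Phase n) (i : Fin n) : potN V x v (pIdx i)
    = x (pIdx i) * v (pIdx i) - potOmega V x ![v, basisVec (qIdx i)] := by
  rw [← deform_potOmega, ← canonicalN_apply_p, sub_eq_add_neg, ← sharpFlat_canonical_p]
  rfl

theorem potOmega_qq (x : Phase n) {i j : Fin n} (hij : i < j) :
    potOmega V x ![basisVec (qIdx j), basisVec (qIdx i)]
      = V i j (x (qIdx i) - x (qIdx j)) := by
  rw [potOmega_apply, ← sum_pairs_delta (fun i j => V i j (x (qIdx i) - x (qIdx j))) hij]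
  refine Finset.sum_congr rfl fun k _ => Finset.sum_congr rfl fun l _ => ?_
  simp only [basisVec, Pi.single_apply, Sum.inl.injEq, reduceCtorEq, if_false]
  ring

theorem potOmega_pp (x : Phase n) {i j : Fin n} (hij : i < j) :
    potOmega V x ![basisVec (pIdx j), basisVec (pIdx i)] = 1 := by
  rw [potOmega_apply, ← sum_pairs_delta (fun _ _ => 1) hij]
  refine Finset.sum_congr rfl fun k _ => Finset.sum_congr rfl fun l _ => ?_
  simp only [basisVec, Pi.single_apply, Sum.inr.injEq, reduceCtorEq, if_false]
  ring

theorem potOmega_qp (x : Phase n) (i j : Fin n) :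
    potOmega V x ![basisVec (qIdx i), basisVec (pIdx j)] = 0 := by
  rw [potOmega_apply]
  simp [basisVec]

/-- The trace of `A N`, expanded in the rank-one terms of `N`. -/
theorem trace_mul_potN (A : Phase n →ₗ[ℝ] Phase n) (x : Phase n) :
    LinearMap.trace ℝ (Phase n) (A * (potN V x : Phase n →ₗ[ℝ] Phase n))
      = ∑ i, x (pIdx i) * (A (basisVec (qIdx i)) (qIdx i) + A (basisVec (pIdx i)) (pIdx i))
        + ∑ i, ∑ j ∈ Finset.Ioi i,
          (A (basisVec (qIdx i)) (pIdx j) - A (basisVec (qIdx j)) (pIdx i))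
        + ∑ i, ∑ j ∈ Finset.Ioi i, V i j (x (qIdx i) - x (qIdx j)) *
          (A (basisVec (pIdx j)) (qIdx i) - A (basisVec (pIdx i)) (qIdx j)) := by
  let T : (Phase n →L[ℝ] Phase n) →ₗ[ℝ] ℝ :=
    { toFun := fun B => LinearMap.trace ℝ (Phase n) (A * (B : Phase n →ₗ[ℝ] Phase n))
      map_add' := fun B C => by simp [mul_add]
      map_smul' := fun c B => by simp }
  have hT (a b : Idx n) : T (tens a b) = A (basisVec a) b := trace_comp_tens A a b
  change T (potN V x) = _
  simp only [potN, map_add, map_sum, map_sub, map_smul, hT, smul_eq_mul]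

theorem traceH_potN_one (x : Phase n) : traceH (potN V) 1 x = ∑ i, x (pIdx i) := by
  have h := trace_mul_potN (V := V) 1 x
  rw [one_mul] at h
  rw [traceH, pow_one, h]
  simp [basisVec, ← two_mul, ← Finset.sum_mul]
  ring

theorem traceH_potN_two (x : Phase n) : traceH (potN V) 2 x = 1 / 2 * ∑ i, x (pIdx i) ^ 2
    + ∑ i, ∑ j ∈ Finset.Ioi i, V i j (x (qIdx i) - x (qIdx j)) := by
  have hq (i : Fin n) : potN V x (basisVec (qIdx i)) (qIdx i) = x (pIdx i) := by
    rw [potN_apply_q, potOmega_qp]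
    simp [basisVec]
  have hp (i : Fin n) : potN V x (basisVec (pIdx i)) (pIdx i) = x (pIdx i) := by
    rw [potN_apply_p, form_swap, potOmega_qp]
    simp [basisVec]
  have hqp (i j : Fin n) (hij : j ∈ Finset.Ioi i) : potN V x (basisVec (qIdx i)) (pIdx j)
      - potN V x (basisVec (qIdx j)) (pIdx i) = 2 * V i j (x (qIdx i) - x (qIdx j)) := by
    rw [potN_apply_p, potN_apply_p, form_swap, potOmega_qq x (Finset.mem_Ioi.1 hij)]
    simp [basisVec]
    ring
  have hpq (i j : Fin n) (hij : j ∈ Finset.Ioi i) : potN V x (basisVec (pIdx j)) (qIdx i)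
      - potN V x (basisVec (pIdx i)) (qIdx j) = 2 := by
    rw [potN_apply_q, potN_apply_q, form_swap _ (basisVec (pIdx j)) (basisVec (pIdx i)),
      potOmega_pp x (Finset.mem_Ioi.1 hij)]
    simp [basisVec]
    norm_num
  rw [traceH, pow_two, trace_mul_potN]
  simp only [ContinuousLinearMap.coe_coe, hq, hp]
  have h1 := Finset.sum_congr (rfl : (Finset.univ : Finset (Fin n)) = _) fun i _ =>
    Finset.sum_congr (rfl : Finset.Ioi i = _) fun j hj => hqp i j hj
  have h2 := Finset.sum_congr (rfl : (Finset.univ : Finset (Fin n)) = _) fun i _ =>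
    Finset.sum_congr (rfl : Finset.Ioi i = _) fun j hj =>
      congrArg (V i j (x (qIdx i) - x (qIdx j)) * ·) (hpq i j hj)
  rw [h1, h2]
  simp only [← two_mul, ← Finset.mul_sum, ← Finset.sum_mul, mul_left_comm _ (2 : ℝ), ← pow_two]
  ring

end Trace

/-! ### The closed and the open Toda lattice -/

section Special
variable {m : ℕ} {f : Fin (m + 2) → ℝ}

theorem todaN_one (hf : ∀ i, f i = 1) : todaN f = closedTodaN m := by
  funext x
  simp [todaN, dasOkuboN, closedTodaN, hf]

theorem todaForm_one (hf : ∀ i, f i = 1) : todaForm f = closedTodaForm m := by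
  funext x
  simp [todaForm, closedTodaForm, hf]

theorem todaN_open (hf : f (Fin.last (m + 1)) = 0) :
    todaN f = dasOkuboN fun i => f i.castSucc := by
  funext x
  simp [todaN, hf]

theorem todaForm_open (hf : f (Fin.last (m + 1)) = 0) (x : Phase (m + 2)) : todaForm f x = 0 := by
  simp [todaForm, hf]

theorem sum_todaV_one (x : Phase (m + 2)) :
    ∑ i : Fin (m + 2), ∑ j ∈ Finset.Ioi i, todaV (fun _ => 1) i j (x (qIdx i) - x (qIdx j))
      = ∑ i : Fin (m + 1), Real.exp (x (qIdx i.castSucc) - x (qIdx i.succ))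
        + Real.exp (x (qIdx (Fin.last (m + 1))) - x (qIdx 0)) := by
  simpa using sum_todaV_smul (fun _ => 1) x fun _ _ => (1 : ℝ)

end Special

end PqN

theorem mainTheorem2 :
    -- arbitrary potentials
    (∀ (n : ℕ) (V : Fin n → Fin n → ℝ → ℝ), (∀ i j, i < j → ContDiff ℝ ∞ (V i j)) →
      IsPN (canonicalP n) (canonicalN n) ∧
      (∀ x, extDeriv (potOmega V) x = 0) ∧
      (∀ W : Fin n → Fin n → ℝ → ℝ, (∀ i j, i < j → ∀ t, HasDerivAt (W i j) (V i j t) t) →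
        ∀ x, extDeriv (potTheta W) x = potOmega V x) ∧
      deform (canonicalP n) (canonicalN n) (potOmega V) = potN V ∧
      dN (canonicalN n) (potOmega V) = potDN V ∧
      koszul (canonicalP n) (potOmega V) (potOmega V) = potKoszul V ∧
      IsPqN (canonicalP n) (deform (canonicalP n) (canonicalN n) (potOmega V))
        (deformForm (canonicalP n) (canonicalN n) (potOmega V))) ∧
    -- Toda potentials, with `n = m + 2` particles
    (∀ (m : ℕ) (f : Fin (m + 2) → ℝ),
      deform (canonicalP (m + 2)) (canonicalN (m + 2)) (potOmega (todaV f)) = todaN f ∧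
      deformForm (canonicalP (m + 2)) (canonicalN (m + 2)) (potOmega (todaV f)) = todaForm f ∧
      IsPqN (canonicalP (m + 2)) (todaN f) (todaForm f) ∧
      -- closed Toda lattice
      ((∀ i, f i = 1) →
        deform (canonicalP (m + 2)) (canonicalN (m + 2)) (potOmega (todaV f)) = closedTodaN m ∧
        deformForm (canonicalP (m + 2)) (canonicalN (m + 2)) (potOmega (todaV f))
          = closedTodaForm m ∧
        IsPqN (canonicalP (m + 2)) (closedTodaN m) (closedTodaForm m) ∧
        (∀ x, traceH (closedTodaN m) 1 x = ∑ i, x (pIdx i)) ∧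
        (∀ x, traceH (closedTodaN m) 2 x = 1 / 2 * ∑ i, x (pIdx i) ^ 2
          + ∑ i : Fin (m + 1), Real.exp (x (qIdx i.castSucc) - x (qIdx i.succ))
          + Real.exp (x (qIdx (Fin.last (m + 1))) - x (qIdx 0)))) ∧
      -- open Toda lattice
      (f (Fin.last (m + 1)) = 0 →
        deform (canonicalP (m + 2)) (canonicalN (m + 2)) (potOmega (todaV f))
          = dasOkuboN (fun i => f i.castSucc) ∧
        (∀ x, dN (canonicalN (m + 2)) (potOmega (todaV f)) x
          + (1 / 2 : ℝ) •
            koszul (canonicalP (m + 2)) (potOmega (todaV f)) (potOmega (todaV f)) x = 0) ∧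
        IsPN (canonicalP (m + 2)) (dasOkuboN (fun i => f i.castSucc)))) := by
  refine ⟨fun n V hV => ⟨isPN_canonical n, extDeriv_potOmega hV,
    fun W hW => extDeriv_potTheta hW, deform_potOmega, dN_potOmega hV, koszul_potOmega hV,
    isPqN_potOmega hV⟩, fun m f => ?_⟩
  have hN : deform (canonicalP (m + 2)) (canonicalN (m + 2)) (potOmega (todaV f)) = todaN f :=
    deform_potOmega.trans (potN_todaV f)
  have hφ := deformForm_todaV f
  refine ⟨hN, hφ, isPqN_toda f, fun hf => ⟨?_, ?_, ?_, fun x => ?_, fun x => ?_⟩,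
    fun hf => ⟨?_, fun x => ?_, ?_⟩⟩
  · rw [hN, todaN_one hf]
  · rw [hφ, todaForm_one hf]
  · rw [← todaN_one hf, ← todaForm_one hf]
    exact isPqN_toda f
  · rw [← todaN_one (f := fun _ => 1) fun _ => rfl, ← potN_todaV]
    exact traceH_potN_one x
  · rw [← todaN_one (f := fun _ => 1) fun _ => rfl, ← potN_todaV, traceH_potN_two, sum_todaV_one,
      add_assoc]
  · rw [hN, todaN_open hf]
  · exact (congrFun hφ x).trans (todaForm_open hf x)
  · rw [← todaN_open hf]
    exact (isPqN_toda f).isPN (todaForm_open hf)
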